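/- Fix integers $N\ge 1$, $N_u$, a time grid $t_{\mathrm i}=t_1<\dots<t_N=t_{\mathrm f}$, a linear system $\dot x=A(t)x+B(t)u+w(t)$ with state in $\mathbb R^{n_x}$, control in $\mathbb R^{n_u}$ and $A,B,w$ continuously differentiable, piecewise polynomial basis functions $\Gamma^1,\dots,\Gamma^{N_u}$ on $[t_{\mathrm i},t_{\mathrm f}]$, and a compact convex set $\mathcal U\subset\mathbb R^{n_uN_u}$. For $U=(u_1,\dots,u_{N_u})$ put $\nu(t)=\sum_j\Gamma^j(t)u_j$, and for $k<N$ let $x^k(t)=\Phi_x(t,t_k)x_k+\Phi_u(t,t_k)U+\phi(t,t_k)$ be the state trajectory on $[t_k,t_{k+1}]$ with control $\nu$ and $x^k(t_k)=x_k$; $A_k,B_k,w_k$ are the values of $\Phi_x(\cdot,t_k),\Phi_u(\cdot,t_k),\phi(\cdot,t_k)$ at $t_{k+1}$. Let $L$ (terminal cost), $Y(t,x,u)$ (running cost), $g(t,x,u)$, $P(x_1,x_N)$ be continuously differentiable and (componentwise) convex in all arguments except time, $h(t,x,u)$ continuously differentiable and affine in $(x,u)$, $Q(x_1,x_N)$ affine.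 Put $$\xi_k(x_k,U)=\int_{t_k}^{t_{k+1}}\sum_i\max\{0,g_i(t,x^k(t),\nu(t))\}^2+\sum_j h_j(t,x^k(t),\nu(t))^2\,\mathrm dt,\qquad Y_k(x_k,U)=\int_{t_k}^{t_{k+1}}Y(t,x^k(t),\nu(t))\,\mathrm dt .$$ For $\epsilon>0$ consider, in $z=(X,U)$, $X=(x_1,\dots,x_N)$, the convex problem $$\min\; L(x_N)+\sum_{k<N}Y_k(x_k,U)\quad\text{s.t.}\quad z\in\mathcal Z,\;\; \xi_k(x_k,U)\le\epsilon\;(k<N),\tag{1}$$ where $\mathcal Z$ is the set of all $z$ with $x_{k+1}=A_kx_k+B_kU+w_k$ $(k<N)$, $Q(x_1,x_N)=0$, $P(x_1,x_N)\le0$, $U\in\mathcal U$. Let $\gamma>0$ and $$\Theta_\gamma(z)=L(x_N)+\sum_{k<N}Y_k(x_k,U)+I_{\mathcal Z}(z)+\gamma\sum_{k<N}\max\{0,\xi_k(x_k,U)-\epsilon\},$$ with $I_{\mathcal Z}$ the indicator function ($0$ on $\mathcal Z$, $+\infty$ elsewhere). Write $\Theta_\gamma=J+H\circ G$ with $H(\zeta)=\zeta_0+\sum_{k<N}\max\{0,\zeta_k\}$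 and either $J=I_{\mathcal Z}$, $G(z)=\big(L(x_N)+\sum_kY_k,\ \gamma(\xi_1-\epsilon),\dots,\gamma(\xi_{N-1}-\epsilon)\big)$, or the same with the term $L(x_N)$ moved from $G$ to $J$. For $\rho>0$ let $$\Theta^\rho_\gamma(z;c)=J(z)+H\big(G(c)+\nabla G(c)(z-c)\big)+\tfrac1{2\rho}\|z-c\|^2,\qquad \mathcal G_\rho(c)=\tfrac1\rho\big(c-\operatorname{argmin}_z\Theta^\rho_\gamma(z;c)\big).$$ The prox-linear method (Algorithm 1), started at $z_1$ with tolerance $\varepsilon>0$ and iteration limit $k_{\max}$, performs $z_{k+1}=\operatorname{argmin}_z\Theta_\gamma^\rho(z;z_k)$ as long as $k\le k_{\max}$ and $\|\mathcal G_\rho(z_k)\|>\varepsilon$, and returns the last iterate. **Theorem.** Assume that 1. the strong Slater assumption holds: the affine equality constraints ($x_{k+1}=A_kx_k+B_kU+w_k$ for $k<N$, and $Q=0$) are linearly independent, and there is a point satisfying them with $\xi_k<\epsilon$ for all $k$, $P<0$ componentwise, and $U$ in the relative interior of $\mathcal U$; 2. problem (1) has a minimizer; 3. $\gamma$ is larger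 than every Lagrange multiplier $\mu_k$ of the constraints $\xi_k\le\epsilon$ associated with a minimizer of (1) (i.e. $\mu\ge0$, complementary slackness holds, and the minimizer minimizes $L(x_N)+\sum_kY_k+\sum_k\mu_k(\xi_k-\epsilon)$ over $\mathcal Z$); 4. $H$ is $\alpha$-Lipschitz, $\nabla G$ is $\beta$-Lipschitz on $\mathcal Z$, with $\alpha\ge 0$, $\beta>0$, and $0<\rho\le\frac1{\alpha\beta}$. Then every subproblem $\min_z\Theta_\gamma^\rho(z;c)$ has a unique minimizer, and for every initial point $z_1$ there is a minimizer $z^\star$ of (1) such that the iterates $z_{k+1}=\operatorname{argmin}_z\Theta_\gamma^\rho(z;z_k)$ converge to $z^\star$, and Algorithm 1 gets arbitrarily close to it in finitely many iterations: for every $\delta>0$ there is $\varepsilon_0>0$ such that for every tolerance $\varepsilon\in(0,\varepsilon_0]$ there is an iteration number $n_0$ such that, whenever $k_{\max}\ge n_0$, the output $\hat z$ of Algorithm 1 satisfies $\|\mathcal G_\rho(\hat z)\|\le\varepsilon$ and $\|\hat z-z^\star\|<\delta$. -/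

import Mathlib

open Set Filter Topology MeasureTheory
open scoped NNReal

noncomputable section

/-- The state space `ℝ^{n}` (also used for the control space), with the Euclidean norm. -/
abbrev Vec (n : ℕ) : Type := EuclideanSpace ℝ (Fin n)

/-- The space of the control coefficients `U = (U_1, …, U_{Nu})`, with the Euclidean norm. -/
abbrev CtrlVec (nu Nu : ℕ) : Type := PiLp 2 (fun _ : Fin Nu => Vec nu)

/-- The space of the decision variable `z = (X, U)`, `X = (x_0, …, x_K)` (the states at `K + 1`
nodes), with the Euclidean norm. -/
abbrev DecVec (nx nu Nu K : ℕ) : Type :=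
  WithLp 2 (PiLp 2 (fun _ : Fin (K + 1) => Vec nx) × CtrlVec nu Nu)

/-- The range of the smooth map `G`: one coordinate for the objective and one for each of the `K`
penalized constraints, with the Euclidean norm. -/
abbrev CompVec (K : ℕ) : Type := WithLp 2 (ℝ × EuclideanSpace ℝ (Fin K))

/-- `φ` is piecewise polynomial on `[a, b]` (with arbitrary values at the breakpoints). -/
def PiecewisePolynomialOn (φ : ℝ → ℝ) (a b : ℝ) : Prop :=
  ∃ (m : ℕ) (s : Fin (m + 1) → ℝ), StrictMono s ∧ s 0 = a ∧ s (Fin.last m) = b ∧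
    ∀ i : Fin m, ∃ p : Polynomial ℝ, ∀ t ∈ Ioo (s i.castSucc) (s i.succ), φ t = p.eval t

/-- `y` is the state trajectory on `[a, c]` of `ẏ(t) = A(t) y(t) + b(t)`, `y(a) = x₀`
(integral form). -/
def IsLinearTrajectory {n : ℕ} (A : ℝ → Vec n →L[ℝ] Vec n) (b : ℝ → Vec n) (a c : ℝ)
    (x₀ : Vec n) (y : ℝ → Vec n) : Prop :=
  ContinuousOn y (Icc a c) ∧ ∀ t ∈ Icc a c, y t = x₀ + ∫ s in a..t, (A s (y s) + b s)

/-- The solution on `[a, c]` of the initial value problem `ẏ = A y + b`, `y(a) = x₀`. -/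
def ivpSolution {n : ℕ} (A : ℝ → Vec n →L[ℝ] Vec n) (b : ℝ → Vec n) (a c : ℝ)
    (x₀ : Vec n) : ℝ → Vec n :=
  Classical.epsilon (IsLinearTrajectory A b a c x₀)

/-- The data of a fixed-time convex optimal control problem with linear dynamics, together with a
control parameterization and a time grid `t_0 < … < t_K` of the time interval `[t_0, t_K]`. -/
structure ConvexOCP (nx nu Nu K ng nh nP nQ : ℕ) where
  /-- the time grid; `t 0` is the initial time and `t (Fin.last K)` the final time -/
  t : Fin (K + 1) → ℝ
  t_strictMono : StrictMono t
  /-- the dynamics `ẋ = A x + B u + w` -/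
  A : ℝ → Vec nx →L[ℝ] Vec nx
  B : ℝ → Vec nu →L[ℝ] Vec nx
  w : ℝ → Vec nx
  A_contDiff : ContDiffOn ℝ 1 A (Icc (t 0) (t (Fin.last K)))
  B_contDiff : ContDiffOn ℝ 1 B (Icc (t 0) (t (Fin.last K)))
  w_contDiff : ContDiffOn ℝ 1 w (Icc (t 0) (t (Fin.last K)))
  /-- the basis functions of the control parameterization -/
  Γ : Fin Nu → ℝ → ℝ
  Γ_piecewise : ∀ j, PiecewisePolynomialOn (Γ j) (t 0) (t (Fin.last K))
  /-- the set of admissible control coefficients -/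
  Uset : Set (CtrlVec nu Nu)
  Uset_compact : IsCompact Uset
  Uset_convex : Convex ℝ Uset
  /-- the terminal cost -/
  L : Vec nx → ℝ
  L_contDiff : ContDiff ℝ 1 L
  L_convex : ConvexOn ℝ univ L
  /-- the running cost -/
  Y : ℝ → Vec nx × Vec nu → ℝ
  Y_contDiff : ContDiffOn ℝ 1 (fun p : ℝ × (Vec nx × Vec nu) => Y p.1 p.2)
    (Icc (t 0) (t (Fin.last K)) ×ˢ univ)
  Y_convex : ∀ τ ∈ Icc (t 0) (t (Fin.last K)), ConvexOn ℝ univ (Y τ)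
  /-- the path constraints `g ≤ 0` -/
  g : ℝ → Vec nx × Vec nu → (Fin ng → ℝ)
  g_contDiff : ContDiffOn ℝ 1 (fun p : ℝ × (Vec nx × Vec nu) => g p.1 p.2)
    (Icc (t 0) (t (Fin.last K)) ×ˢ univ)
  g_convex : ∀ τ ∈ Icc (t 0) (t (Fin.last K)), ∀ i, ConvexOn ℝ univ (fun p => g τ p i)
  /-- the path constraints `h = 0`, affine in state and control -/
  h : ℝ → (Vec nx × Vec nu) →ᵃ[ℝ] (Fin nh → ℝ)
  h_contDiff : ContDiffOn ℝ 1 (fun p : ℝ × (Vec nx × Vec nu) => h p.1 p.2)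
    (Icc (t 0) (t (Fin.last K)) ×ˢ univ)
  /-- the boundary constraints `P ≤ 0` on the initial and the final state -/
  P : Vec nx × Vec nx → (Fin nP → ℝ)
  P_contDiff : ContDiff ℝ 1 P
  P_convex : ∀ i, ConvexOn ℝ univ (fun p => P p i)
  /-- the boundary constraints `Q = 0` on the initial and the final state -/
  Q : (Vec nx × Vec nx) →ᵃ[ℝ] (Fin nQ → ℝ)

namespace ConvexOCP

variable {nx nu Nu K ng nh nP nQ : ℕ} (D : ConvexOCP nx nu Nu K ng nh nP nQ)

/-- The parameterized control `ν(s) = ∑ j, Γ_j(s) U_j`. -/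
def ctrl (U : CtrlVec nu Nu) (s : ℝ) : Vec nu := ∑ j, D.Γ j s • U j

/-- `Φ_x(s, t_k) x`, for `s ∈ [t_k, t_{k+1}]`. -/
def PhiX (k : Fin K) (x : Vec nx) : ℝ → Vec nx :=
  ivpSolution D.A (fun _ => 0) (D.t k.castSucc) (D.t k.succ) x

/-- `Φ_u(s, t_k) U`, for `s ∈ [t_k, t_{k+1}]`. -/
def PhiU (k : Fin K) (U : CtrlVec nu Nu) : ℝ → Vec nx :=
  ivpSolution D.A (fun s => D.B s (D.ctrl U s)) (D.t k.castSucc) (D.t k.succ) 0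

/-- `φ(s, t_k)`, for `s ∈ [t_k, t_{k+1}]`. -/
def phi (k : Fin K) : ℝ → Vec nx :=
  ivpSolution D.A D.w (D.t k.castSucc) (D.t k.succ) 0

/-- The state trajectory `x^k` on `[t_k, t_{k+1}]` with initial condition `x` at `t_k`. -/
def traj (k : Fin K) (x : Vec nx) (U : CtrlVec nu Nu) (s : ℝ) : Vec nx :=
  D.PhiX k x s + D.PhiU k U s + D.phi k s

/-- The integrated violation of the path constraints on `[t_k, t_{k+1}]`. -/
def xi (k : Fin K) (x : Vec nx) (U : CtrlVec nu Nu) : ℝ :=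
  ∫ s in (D.t k.castSucc)..(D.t k.succ),
    ((∑ i, (max 0 (D.g s (D.traj k x U s, D.ctrl U s) i)) ^ 2)
      + ∑ j, (D.h s (D.traj k x U s, D.ctrl U s) j) ^ 2)

/-- The running cost accumulated on `[t_k, t_{k+1}]`. -/
def Yk (k : Fin K) (x : Vec nx) (U : CtrlVec nu Nu) : ℝ :=
  ∫ s in (D.t k.castSucc)..(D.t k.succ), D.Y s (D.traj k x U s, D.ctrl U s)

/-- The residuals of all equality constraints: `x_{k+1} - (A_k x_k + B_k U + w_k)`, where
`A_k = Φ_x(t_{k+1}, t_k)`, `B_k = Φ_u(t_{k+1}, t_k)`, `w_k = φ(t_{k+1}, t_k)`, and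
`Q(x_0, x_K)`. -/
def eqResidual (z : DecVec nx nu Nu K) : (Fin K → Vec nx) × (Fin nQ → ℝ) :=
  (fun k => z.fst k.succ -
      (D.PhiX k (z.fst k.castSucc) (D.t k.succ) + D.PhiU k z.snd (D.t k.succ)
        + D.phi k (D.t k.succ)),
    D.Q (z.fst 0, z.fst (Fin.last K)))

/-- The closed convex set `𝒵` of all constraints but the (penalized) path constraints. -/
def Zset : Set (DecVec nx nu Nu K) :=
  {z | D.eqResidual z = 0 ∧ (∀ i, D.P (z.fst 0, z.fst (Fin.last K)) i ≤ 0) ∧ z.snd ∈ D.Uset}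

/-- The objective `L(x_K) + ∑ k, Y_k(x_k, U)`. -/
def objective (z : DecVec nx nu Nu K) : ℝ :=
  D.L (z.fst (Fin.last K)) + ∑ k : Fin K, D.Yk k (z.fst k.castSucc) z.snd

/-- The feasible set of the discretized problem with `ε`-relaxed path constraints. -/
def feasible (ε : ℝ) : Set (DecVec nx nu Nu K) :=
  {z | z ∈ D.Zset ∧ ∀ k : Fin K, D.xi k (z.fst k.castSucc) z.snd ≤ ε}

/-- `z` is a minimizer (a solution) of the discretized problem. -/
def IsSolution (ε : ℝ) (z : DecVec nx nu Nu K) : Prop :=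
  z ∈ D.feasible ε ∧ ∀ z' ∈ D.feasible ε, D.objective z ≤ D.objective z'

/-- The strong Slater assumption: the (affine) equality constraints are linearly independent, that
is, their residual map is onto, and some point satisfies them, satisfies all inequality constraints
strictly, and has its controls in the relative interior of the set of admissible ones. -/
def StrongSlater (ε : ℝ) : Prop :=
  Function.Surjective D.eqResidual ∧
    ∃ z : DecVec nx nu Nu K, D.eqResidual z = 0 ∧
      (∀ k : Fin K, D.xi k (z.fst k.castSucc) z.snd < ε) ∧
      (∀ i, D.P (z.fst 0, z.fst (Fin.last K)) i < 0) ∧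
      z.snd ∈ intrinsicInterior ℝ D.Uset

/-- `μ` is a vector of Lagrange multipliers of the relaxed path constraints `ξ_k ≤ ε`, associated
with the solution `z`: nonnegative, complementary, and `z` minimizes the Lagrangian over `𝒵`. -/
def IsMultiplier (ε : ℝ) (z : DecVec nx nu Nu K) (μ : Fin K → ℝ) : Prop :=
  (∀ k, 0 ≤ μ k) ∧ (∀ k, μ k * (D.xi k (z.fst k.castSucc) z.snd - ε) = 0) ∧
    ∀ z' ∈ D.Zset,
      D.objective z + ∑ k, μ k * (D.xi k (z.fst k.castSucc) z.snd - ε)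
        ≤ D.objective z' + ∑ k, μ k * (D.xi k (z'.fst k.castSucc) z'.snd - ε)

open Classical in
/-- The indicator function of `𝒵`. -/
def indicatorZ (z : DecVec nx nu Nu K) : EReal := if z ∈ D.Zset then 0 else ⊤

/-- The penalized objective `Θ_γ`. -/
def Theta (ε γ : ℝ) (z : DecVec nx nu Nu K) : EReal :=
  D.indicatorZ z + ((D.objective z
    + γ * ∑ k : Fin K, max 0 (D.xi k (z.fst k.castSucc) z.snd - ε) : ℝ) : EReal)

/-- The convex part `J` of the composite form `Θ_γ = J + H ∘ G`. The flag tells whether the (convex)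
terminal cost is kept in `J` (`true`) or is linearized as a part of `G` (`false`). -/
def J (keepL : Bool) (z : DecVec nx nu Nu K) : EReal :=
  D.indicatorZ z + ((if keepL then D.L (z.fst (Fin.last K)) else 0 : ℝ) : EReal)

/-- The smooth part `G` of the composite form: the objective (without the part of it that is kept in
`J`) and the functions `γ (ξ_k - ε)`. -/
def G (keepL : Bool) (ε γ : ℝ) (z : DecVec nx nu Nu K) : CompVec K :=
  WithLp.toLp 2
    ((if keepL then 0 else D.L (z.fst (Fin.last K)))
        + ∑ k : Fin K, D.Yk k (z.fst k.castSucc) z.snd,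
      WithLp.toLp 2 (fun k : Fin K => γ * (D.xi k (z.fst k.castSucc) z.snd - ε)))

end ConvexOCP

/-- The outer convex function `H(ζ) = ζ_L + ∑ k, max (0, ζ_k)` of the composite form. -/
def outerH {K : ℕ} (ζ : CompVec K) : ℝ := ζ.fst + ∑ k, max 0 (ζ.snd k)

namespace ConvexOCP

variable {nx nu Nu K ng nh nP nQ : ℕ} (D : ConvexOCP nx nu Nu K ng nh nP nQ)

theorem Theta_eq_composite (keepL : Bool) (ε γ : ℝ) (hγ : 0 ≤ γ) (z : DecVec nx nu Nu K) :
    D.Theta ε γ z = D.J keepL z + ((outerH (D.G keepL ε γ z) : ℝ) : EReal) := by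
  have h : ∀ k : Fin K, max 0 (γ * (D.xi k (z.fst k.castSucc) z.snd - ε))
      = γ * max 0 (D.xi k (z.fst k.castSucc) z.snd - ε) := fun k => by
    rw [mul_max_of_nonneg _ _ hγ, mul_zero]
  have h2 : outerH (D.G keepL ε γ z) = (if keepL then 0 else D.L (z.fst (Fin.last K)))
        + ∑ k : Fin K, D.Yk k (z.fst k.castSucc) z.snd
        + γ * ∑ k : Fin K, max 0 (D.xi k (z.fst k.castSucc) z.snd - ε) := by
    rw [Finset.mul_sum, ← Finset.sum_congr rfl (fun k _ => h k)]
    rfl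
  rw [Theta, J, add_assoc, ← EReal.coe_add, h2, objective]
  congr 2
  cases keepL <;> simp <;> ring

/-- The convex model `Θ_γ^ρ(z; c)` of `Θ_γ` around the point `c`. -/
def proxModel (keepL : Bool) (ε γ ρ : ℝ) (c z : DecVec nx nu Nu K) : EReal :=
  D.J keepL z +
    ((outerH (D.G keepL ε γ c + fderiv ℝ (D.G keepL ε γ) c (z - c))
      + 1 / (2 * ρ) * ‖z - c‖ ^ 2 : ℝ) : EReal)

/-- `z` is a minimizer of the model around `c`. -/
def IsProxMin (keepL : Bool) (ε γ ρ : ℝ) (c z : DecVec nx nu Nu K) : Prop :=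
  ∀ z', D.proxModel keepL ε γ ρ c z ≤ D.proxModel keepL ε γ ρ c z'

/-- The minimizer of the model around `c`. -/
def proxStep (keepL : Bool) (ε γ ρ : ℝ) (c : DecVec nx nu Nu K) : DecVec nx nu Nu K :=
  Classical.epsilon (D.IsProxMin keepL ε γ ρ c)

/-- The prox-gradient mapping `𝒢_ρ`. -/
def proxGrad (keepL : Bool) (ε γ ρ : ℝ) (c : DecVec nx nu Nu K) : DecVec nx nu Nu K :=
  (1 / ρ) • (c - D.proxStep keepL ε γ ρ c)

/-- The output of the prox-linear method with tolerance `tol`, after at most the given number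
of iterations: iterate `z ← proxStep z` as long as `‖𝒢_ρ(z)‖ > tol`. -/
def proxLinear (keepL : Bool) (ε γ ρ tol : ℝ) :
    ℕ → DecVec nx nu Nu K → DecVec nx nu Nu K
  | 0, z => z
  | n + 1, z =>
    open Classical in
    if tol < ‖D.proxGrad keepL ε γ ρ z‖ then
      proxLinear keepL ε γ ρ tol n (D.proxStep keepL ε γ ρ z)
    else z

end ConvexOCP

end

/-!
The proof shows that a prox-linear step obeys the same three-point inequality as an exact proximal
step. The functions `ξ_k` and `Y_k` are convex and differentiable in `z`, since the state and the
control at a given time are affine in `z` (`path_eq`). The linearization of `G` at `c` therefore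
stays below `G`, and as `H` is monotone, the linearized objective stays below `Θ_γ`
(`linModel_le_penalized`). Conversely, by the descent lemma and `ρ ≤ 1 / (α β)`, adding the proximal
term puts the model above `Θ_γ` on `𝒵` (`penalized_le_linModel_add`). The model is strongly convex,
so that it has a unique minimizer `c⁺`, with quadratic growth around it (`IsProxMin.growth`).
Together, for `c ∈ 𝒵` and `r = 1 / (2 ρ)`,
`Θ_γ(c⁺) + r ‖z - c⁺‖² ≤ Θ_γ(z) + r ‖z - c‖²` for all `z ∈ 𝒵`.

Such an inequality makes the iterates Fejér monotone with respect to the minimizers of `Θ_γ` and the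
excess values summable, so that the iterates converge to a minimizer of `Θ_γ` as soon as there is
one (`exists_tendsto_minimizer_of_prox_inequality`). Slater's condition provides multipliers for a
solution of the constrained problem (`exists_lagrange_multiplier`), and since `γ` exceeds them, the
minimizers of `Θ_γ` are exactly the solutions (`IsSolution.exact_penalty`).

The affine dependence of the state on `z` rests on existence and uniqueness for linear initial value
problems whose inhomogeneity is merely integrable, as the control may jump at the breakpoints of the
basis functions. For the same reason the differentiation under the integral sign is done for
families of affine maps that are bounded and measurable in time.
-/

noncomputable section

/-! ### Convex analysis -/

section Convexity

variable {E F : Type*} [NormedAddCommGroup E] [NormedSpace ℝ E]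
  [NormedAddCommGroup F] [NormedSpace ℝ F]

theorem ConvexOn.le_of_hasFDerivAt {f : E → ℝ} (hf : ConvexOn ℝ univ f) {c : E}
    {f' : E →L[ℝ] ℝ} (hc : HasFDerivAt f f' c) (z : E) : f c + f' (z - c) ≤ f z := by
  have h1 : ConvexOn ℝ univ (fun τ : ℝ => f (AffineMap.lineMap c z τ)) := by
    have := hf.comp_affineMap (AffineMap.lineMap c z : ℝ →ᵃ[ℝ] E)
    simpa [Function.comp_def] using this
  have h2 : HasDerivAt (fun τ : ℝ => f (AffineMap.lineMap c z τ)) (f' (z - c)) 0 := by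
    have h3 : HasFDerivAt f f' (AffineMap.lineMap c z (0 : ℝ)) := by simpa using hc
    exact h3.comp_hasDerivAt 0 (AffineMap.hasDerivAt_lineMap (a := c) (b := z))
  have h4 := h1.le_slope_of_hasDerivAt (mem_univ 0) (mem_univ 1) one_pos h2
  rw [map_sub] at h4 ⊢
  simp [slope_def_field] at h4
  linarith

/-- The descent lemma: on a convex set where the derivative is `β`-Lipschitz, the linearization
error is at most `β / 2` times the squared distance. -/
theorem Convex.norm_sub_linearization_le {s : Set E} (hs : Convex ℝ s) {G : E → F}
    {G' : E → E →L[ℝ] F} (hG : ∀ x ∈ s, HasFDerivAt G (G' x) x) {β : ℝ≥0}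
    (hL : LipschitzOnWith β G' s) {c z : E} (hc : c ∈ s) (hz : z ∈ s) :
    ‖G z - (G c + G' c (z - c))‖ ≤ β / 2 * ‖z - c‖ ^ 2 := by
  have hmem : ∀ τ ∈ Icc (0 : ℝ) 1, c + τ • (z - c) ∈ s := fun τ hτ =>
    hs.add_smul_sub_mem hc hz hτ
  have hline : ∀ τ : ℝ, HasDerivAt (fun τ : ℝ => c + τ • (z - c)) (z - c) τ := fun τ => by
    simpa using ((hasDerivAt_id τ).smul_const (z - c)).const_add c
  have hder : ∀ τ ∈ Icc (0 : ℝ) 1,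
      HasDerivAt (fun τ : ℝ => G (c + τ • (z - c)) - (G c + τ • G' c (z - c)))
        (G' (c + τ • (z - c)) (z - c) - G' c (z - c)) τ := fun τ hτ => by
    have h1 := (hG _ (hmem τ hτ)).comp_hasDerivAt τ (hline τ)
    have h2 : HasDerivAt (fun τ : ℝ => G c + τ • G' c (z - c)) (G' c (z - c)) τ := by
      simpa using ((hasDerivAt_id τ).smul_const (G' c (z - c))).const_add (G c)
    exact h1.sub h2
  have key := image_norm_le_of_norm_deriv_right_le_deriv_boundary
    (f := fun τ : ℝ => G (c + τ • (z - c)) - (G c + τ • G' c (z - c)))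
    (f' := fun τ => G' (c + τ • (z - c)) (z - c) - G' c (z - c))
    (B := fun τ => β / 2 * ‖z - c‖ ^ 2 * τ ^ 2) (B' := fun τ => β * ‖z - c‖ ^ 2 * τ)
    (a := 0) (b := 1)
    (fun τ hτ => (hder τ hτ).continuousAt.continuousWithinAt)
    (fun τ hτ => (hder τ (Ico_subset_Icc_self hτ)).hasDerivWithinAt)
    (by simp) (fun τ => by
      have := (hasDerivAt_pow 2 τ).const_mul ((β : ℝ) / 2 * ‖z - c‖ ^ 2)
      refine this.congr_deriv ?_
      norm_num
      ring)
    (fun τ hτ => by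
      have h1 := hL.dist_le_mul _ (hmem τ (Ico_subset_Icc_self hτ)) _ hc
      rw [dist_eq_norm, dist_eq_norm, add_sub_cancel_left, norm_smul, Real.norm_eq_abs,
        abs_of_nonneg hτ.1] at h1
      calc ‖G' (c + τ • (z - c)) (z - c) - G' c (z - c)‖
          = ‖(G' (c + τ • (z - c)) - G' c) (z - c)‖ := by simp
        _ ≤ ‖G' (c + τ • (z - c)) - G' c‖ * ‖z - c‖ := ContinuousLinearMap.le_opNorm _ _
        _ ≤ (β * (τ * ‖z - c‖)) * ‖z - c‖ := by gcongr
        _ = β * ‖z - c‖ ^ 2 * τ := by ring)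
    (right_mem_Icc.2 zero_le_one)
  simpa using key

end Convexity

/-! ### Proximal steps -/

section Prox

variable {E : Type*} [NormedAddCommGroup E] [InnerProductSpace ℝ E]

theorem norm_sq_convex_combination (a b : E) (τ : ℝ) :
    ‖(1 - τ) • a + τ • b‖ ^ 2
      = (1 - τ) * ‖a‖ ^ 2 + τ * ‖b‖ ^ 2 - τ * (1 - τ) * ‖b - a‖ ^ 2 := by
  rw [norm_add_sq_real, norm_sub_sq_real, norm_smul, norm_smul, inner_smul_left, inner_smul_right,
    real_inner_comm, mul_pow, mul_pow, Real.norm_eq_abs, Real.norm_eq_abs, sq_abs, sq_abs]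
  simp
  ring

/-- A minimizer of a convex function plus `r ‖· - c‖²` is a sharp minimizer, with quadratic growth
of modulus `r`. -/
theorem ConvexOn.prox_growth {s : Set E} {ψ : E → ℝ} (hψ : ConvexOn ℝ s ψ) {r : ℝ} {c p : E}
    (hp : p ∈ s) (hmin : ∀ z ∈ s, ψ p + r * ‖p - c‖ ^ 2 ≤ ψ z + r * ‖z - c‖ ^ 2)
    {z : E} (hz : z ∈ s) :
    ψ p + r * ‖p - c‖ ^ 2 + r * ‖z - p‖ ^ 2 ≤ ψ z + r * ‖z - c‖ ^ 2 := by
  have h : ∀ τ ∈ Ioo (0 : ℝ) 1, ψ p + r * ‖p - c‖ ^ 2 + (1 - τ) * (r * ‖z - p‖ ^ 2)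
      ≤ ψ z + r * ‖z - c‖ ^ 2 := fun τ hτ => by
    have h1 := hψ.2 hp hz (sub_nonneg.2 hτ.2.le) hτ.1.le (sub_add_cancel 1 τ)
    have h2 := hmin _ (hψ.1 hp hz (sub_nonneg.2 hτ.2.le) hτ.1.le (sub_add_cancel 1 τ))
    have h3 : (1 - τ) • p + τ • z - c = (1 - τ) • (p - c) + τ • (z - c) := by module
    rw [h3, norm_sq_convex_combination, sub_sub_sub_cancel_right] at h2
    simp only [smul_eq_mul] at h1
    have h4 : τ * (ψ p + r * ‖p - c‖ ^ 2 + (1 - τ) * (r * ‖z - p‖ ^ 2))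
        ≤ τ * (ψ z + r * ‖z - c‖ ^ 2) := by linarith
    exact le_of_mul_le_mul_left h4 hτ.1
  have hlim : Tendsto (fun τ : ℝ => ψ p + r * ‖p - c‖ ^ 2 + (1 - τ) * (r * ‖z - p‖ ^ 2))
      (𝓝[>] 0) (𝓝 (ψ p + r * ‖p - c‖ ^ 2 + (1 - 0) * (r * ‖z - p‖ ^ 2))) :=
    tendsto_nhdsWithin_of_tendsto_nhds (Continuous.tendsto (by fun_prop) 0)
  have := le_of_tendsto hlim (by filter_upwards [Ioo_mem_nhdsGT zero_lt_one] with τ hτ using h τ hτ)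
  simpa using this

end Prox

section Existence

variable {E : Type*} [NormedAddCommGroup E]

/-- A continuous function with at most linear decrease attains its minimum on a closed set after
the addition of `r ‖· - c‖²`. -/
theorem exists_prox_minimizer [ProperSpace E] {s : Set E} (hs : IsClosed s) (hne : s.Nonempty)
    {ψ : E → ℝ} (hψ : Continuous ψ) {a b r : ℝ} (hr : 0 < r) (c : E)
    (hlow : ∀ z, a - b * ‖z - c‖ ≤ ψ z) :
    ∃ p ∈ s, ∀ z ∈ s, ψ p + r * ‖p - c‖ ^ 2 ≤ ψ z + r * ‖z - c‖ ^ 2 := by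
  obtain ⟨z₀, hz₀⟩ := hne
  have hlim : Tendsto (fun z : E => a - b * ‖z - c‖ + r * ‖z - c‖ ^ 2) (cocompact E) atTop := by
    have h1 : Tendsto (fun x : ℝ => a + x * (r * x - b)) atTop atTop :=
      tendsto_atTop_add_const_left _ _ (tendsto_id.atTop_mul_atTop₀
        (tendsto_atTop_add_const_right _ (-b) (tendsto_id.const_mul_atTop hr)))
    have h2 : Tendsto (fun z : E => ‖z - c‖) (cocompact E) atTop := by
      simpa [dist_eq_norm] using tendsto_dist_right_cocompact_atTop c
    refine (h1.comp h2).congr fun z => ?_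
    simp only [Function.comp]
    ring
  obtain ⟨p, hp, hmin⟩ := ContinuousOn.exists_isMinOn' (s := s)
    (f := fun z => ψ z + r * ‖z - c‖ ^ 2) (by fun_prop) hs hz₀
    (by
      have := (hlim.eventually_ge_atTop (ψ z₀ + r * ‖z₀ - c‖ ^ 2)).filter_mono
        (inf_le_left : cocompact E ⊓ 𝓟 s ≤ cocompact E)
      filter_upwards [this] with z hz
      linarith [hlow z])
  exact ⟨p, hp, fun z hz => hmin hz⟩

/-- Convergence of a proximal-type iteration. The inequality with `w` a minimizer makes the values
summable above the minimum and the sequence Fejér monotone with respect to the minimizers, so that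
a cluster point is a minimizer and the limit of the whole sequence. -/
theorem exists_tendsto_minimizer_of_prox_inequality [ProperSpace E] {s : Set E} (hs : IsClosed s)
    {θ : E → ℝ} (hθ : Continuous θ) {r : ℝ} (hr : 0 < r) {u : ℕ → E} (hu : ∀ n, u n ∈ s)
    (hstep : ∀ n, ∀ z ∈ s, θ (u (n + 1)) + r * ‖z - u (n + 1)‖ ^ 2 ≤ θ z + r * ‖z - u n‖ ^ 2)
    {w : E} (hw : w ∈ s) (hmin : ∀ z ∈ s, θ w ≤ θ z) :
    ∃ y ∈ s, (∀ z ∈ s, θ y ≤ θ z) ∧ Tendsto u atTop (𝓝 y) := by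
  have hanti : ∀ y ∈ s, (∀ z ∈ s, θ y ≤ θ z) → Antitone (fun n => ‖y - u n‖) := fun y hy hym =>
    antitone_nat_of_succ_le fun n => by
      have h1 := hstep n y hy
      have h2 := hym _ (hu (n + 1))
      have h3 : r * ‖y - u (n + 1)‖ ^ 2 ≤ r * ‖y - u n‖ ^ 2 := by linarith
      exact (sq_le_sq₀ (norm_nonneg _) (norm_nonneg _)).1 (le_of_mul_le_mul_left h3 hr)
  have hsum : ∀ n, ∑ i ∈ Finset.range n, (θ (u (i + 1)) - θ w)
      ≤ r * ‖w - u 0‖ ^ 2 - r * ‖w - u n‖ ^ 2 := fun n => by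
    induction n with
    | zero => simp
    | succ n ih =>
      rw [Finset.sum_range_succ]
      linarith [hstep n w hw]
  have hval : Tendsto (fun n => θ (u (n + 1))) atTop (𝓝 (θ w)) := by
    have hsm : Summable (fun n => θ (u (n + 1)) - θ w) :=
      summable_of_sum_range_le (c := r * ‖w - u 0‖ ^ 2)
        (fun n => sub_nonneg.2 (hmin _ (hu _))) fun n => (hsum n).trans
          (sub_le_self _ (by positivity))
    simpa using hsm.tendsto_atTop_zero.add_const (θ w)
  have hbdd : ∀ n, u (n + 1) ∈ Metric.closedBall w ‖w - u 0‖ := fun n => by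
    rw [Metric.mem_closedBall, dist_comm, dist_eq_norm]
    exact hanti w hw hmin (Nat.zero_le _)
  obtain ⟨y, -, φ, hφ, hlim⟩ := (isCompact_closedBall w ‖w - u 0‖).tendsto_subseq hbdd
  have hy : y ∈ s := hs.mem_of_tendsto hlim (Eventually.of_forall fun n => hu _)
  have hyval : θ y = θ w :=
    tendsto_nhds_unique ((hθ.tendsto y).comp hlim) (hval.comp hφ.tendsto_atTop)
  have hym : ∀ z ∈ s, θ y ≤ θ z := fun z hz => hyval ▸ hmin z hz
  refine ⟨y, hy, hym, ?_⟩
  rw [Metric.tendsto_atTop]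
  intro δ hδ
  obtain ⟨n, hn⟩ := (Metric.tendsto_atTop.1 hlim) δ hδ
  refine ⟨φ n + 1, fun m hm => ?_⟩
  have h1 := hanti y hy hym hm
  have h2 := hn n le_rfl
  rw [dist_comm, dist_eq_norm] at h2 ⊢
  exact lt_of_le_of_lt h1 h2

end Existence

/-! ### Lagrange multipliers -/

section Multiplier

variable {E : Type*} [AddCommGroup E] [Module ℝ E]

/-- Lagrange duality under Slater's condition: separate the origin from the open convex set of
the `(r, v)` that strictly exceed the values `(f z - f z₀, g z)` at some `z`. -/
theorem exists_lagrange_multiplier {ι : Type*} [Fintype ι] {s : Set E} {f : E → ℝ}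
    (hf : ConvexOn ℝ s f) {g : ι → E → ℝ} (hg : ∀ i, ConvexOn ℝ s (g i)) {z₀ : E} (hz₀ : z₀ ∈ s)
    (hfeas : ∀ i, g i z₀ ≤ 0) (hmin : ∀ z ∈ s, (∀ i, g i z ≤ 0) → f z₀ ≤ f z)
    {zs : E} (hzs : zs ∈ s) (hslater : ∀ i, g i zs < 0) :
    ∃ μ : ι → ℝ, (∀ i, 0 ≤ μ i) ∧ (∀ i, μ i * g i z₀ = 0) ∧
      ∀ z ∈ s, f z₀ ≤ f z + ∑ i, μ i * g i z := by
  classical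
  set C : Set (ℝ × (ι → ℝ)) := {p | ∃ z ∈ s, f z - f z₀ < p.1 ∧ ∀ i, g i z < p.2 i} with hC
  have hCconv : Convex ℝ C := by
    rintro p ⟨y, hy, hy1, hy2⟩ q ⟨z, hz, hz1, hz2⟩ a b ha hb hab
    refine ⟨a • y + b • z, hf.1 hy hz ha hb hab, ?_, fun i => ?_⟩
    · have h1 := hf.2 hy hz ha hb hab
      have h2 : f z₀ = a * f z₀ + b * f z₀ := by rw [← add_mul, hab, one_mul]
      simp only [smul_eq_mul, Prod.fst_add, Prod.smul_fst] at h1 ⊢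
      rcases ha.eq_or_lt with rfl | ha
      · obtain rfl : b = 1 := by linarith
        simp at h1 ⊢
        linarith
      · nlinarith [mul_lt_mul_of_pos_left hy1 ha, mul_le_mul_of_nonneg_left hz1.le hb]
    · have h1 := (hg i).2 hy hz ha hb hab
      simp only [smul_eq_mul, Prod.snd_add, Prod.smul_snd, Pi.add_apply, Pi.smul_apply] at h1 ⊢
      rcases ha.eq_or_lt with rfl | ha
      · obtain rfl : b = 1 := by linarith
        simp at h1 ⊢
        linarith [hz2 i]
      · nlinarith [mul_lt_mul_of_pos_left (hy2 i) ha, mul_le_mul_of_nonneg_left (hz2 i).le hb]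
  have hCopen : IsOpen C := by
    have : C = ⋃ z ∈ s, {p : ℝ × (ι → ℝ) | f z - f z₀ < p.1 ∧ ∀ i, g i z < p.2 i} := by
      ext p; simp [hC, and_left_comm]
    rw [this]
    refine isOpen_biUnion fun z _ => ?_
    rw [ofPred_and, ofPred_forall]
    exact (isOpen_lt continuous_const continuous_fst).inter
      (isOpen_iInter_of_finite fun i => isOpen_lt continuous_const (by fun_prop))
  have h0 : (0 : ℝ × (ι → ℝ)) ∉ C := by
    rintro ⟨z, hz, h1, h2⟩
    have := hmin z hz fun i => (h2 i).le
    simp at h1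
    linarith
  obtain ⟨φ, hφ⟩ := geometric_hahn_banach_open_point hCconv hCopen h0
  set l : ℝ := -φ (1, 0) with hl
  set m : ι → ℝ := fun i => -φ (0, Pi.single i 1) with hm
  have hrep : ∀ r v, φ (r, v) = -(l * r + ∑ i, m i * v i) := fun r v => by
    have h1 : ((r, v) : ℝ × (ι → ℝ))
        = r • ((1, 0) : ℝ × (ι → ℝ)) + ∑ i, v i • ((0, Pi.single i 1) : ℝ × (ι → ℝ)) := by
      refine Prod.ext ?_ ?_
      · simp [Prod.fst_sum]
      · simp only [Prod.snd_add, Prod.smul_snd, smul_zero, zero_add, Prod.snd_sum]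
        ext j
        simp [Finset.sum_apply, Pi.single_apply]
    rw [h1, map_add, map_sum, map_smul]
    simp only [map_smul, smul_eq_mul, hl, hm, neg_mul, Finset.sum_neg_distrib]
    rw [neg_add, neg_neg, neg_neg, mul_comm]
    congr 1
    exact Finset.sum_congr rfl fun i _ => mul_comm _ _
  have hpos : ∀ z ∈ s, ∀ (r : ℝ) (v : ι → ℝ), f z - f z₀ < r → (∀ i, g i z < v i) →
      0 < l * r + ∑ i, m i * v i := fun z hz r v h1 h2 => by
    have := hφ (r, v) ⟨z, hz, h1, h2⟩
    rw [map_zero, hrep] at this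
    linarith
  -- Passing to the limit from above, nonstrict inequalities suffice for a nonstrict conclusion.
  have hnn : ∀ z ∈ s, ∀ (r : ℝ) (v : ι → ℝ), f z - f z₀ ≤ r → (∀ i, g i z ≤ v i) →
      0 ≤ l * r + ∑ i, m i * v i := fun z hz r v h1 h2 => by
    have hlim : Tendsto (fun e : ℝ => l * (r + e) + ∑ i, m i * (v i + e)) (𝓝[>] 0)
        (𝓝 (l * (r + 0) + ∑ i, m i * (v i + 0))) :=
      tendsto_nhdsWithin_of_tendsto_nhds (Continuous.tendsto (by fun_prop) 0)
    have := ge_of_tendsto hlim (b := 0) (by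
      filter_upwards [self_mem_nhdsWithin] with e he
      have he : 0 < e := he
      exact (hpos z hz (r + e) (fun i => v i + e) (by linarith)
        fun i => by linarith [h2 i]).le)
    simpa using this
  have hl0 : 0 ≤ l := by
    have h1 := hnn z₀ hz₀ 1 (fun _ => 0) (by simp) hfeas
    simpa using h1
  have hm0 : ∀ i, 0 ≤ m i := fun i => by
    have h1 := hnn z₀ hz₀ 0 (Pi.single i 1) (by simp) fun j =>
      (hfeas j).trans (by rcases eq_or_ne j i with rfl | h <;> simp [*])
    simpa [Pi.single_apply] using h1
  have hlpos : 0 < l := by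
    refine hl0.lt_of_ne fun h => ?_
    have h1 := hpos zs hzs (f zs - f z₀ + 1) (fun _ => 0) (by linarith) hslater
    rw [← h] at h1
    simp at h1
  refine ⟨fun i => m i / l, fun i => div_nonneg (hm0 i) hl0, fun i => ?_, fun z hz => ?_⟩
  · have h1 := hnn z₀ hz₀ 0 (fun j => g j z₀) (by simp) fun j => le_rfl
    rw [mul_zero, zero_add] at h1
    have h2 : ∀ j ∈ Finset.univ, m j * g j z₀ ≤ 0 := fun j _ =>
      mul_nonpos_of_nonneg_of_nonpos (hm0 j) (hfeas j)
    have h3 := (Finset.sum_eq_zero_iff_of_nonpos h2).1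
      (le_antisymm (Finset.sum_nonpos h2) h1) i (Finset.mem_univ i)
    rw [div_mul_eq_mul_div, h3, zero_div]
  · have h1 := hnn z hz (f z - f z₀) (fun i => g i z) le_rfl fun i => le_rfl
    have h2 : l * (f z - f z₀) + ∑ i, m i * g i z
        = l * (f z + ∑ i, m i / l * g i z - f z₀) := by
      rw [add_sub_right_comm, mul_add, Finset.mul_sum]
      congr 1
      refine Finset.sum_congr rfl fun i _ => ?_
      field_simp
    rw [h2] at h1
    linarith [nonneg_of_mul_nonneg_right h1 hlpos]

end Multiplier

/-! ### Linear initial value problems -/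

section LinearODE

variable {n : ℕ} {A : ℝ → Vec n →L[ℝ] Vec n} {a c : ℝ}

theorem intervalIntegrable_apply_trajectory (hA : ContinuousOn A (Icc a c)) {y : ℝ → Vec n}
    (hy : ContinuousOn y (Icc a c)) {t : ℝ} (ht : t ∈ Icc a c) :
    IntervalIntegrable (fun s => A s (y s)) volume a t :=
  ContinuousOn.intervalIntegrable <| by
    rw [uIcc_of_le ht.1]
    exact (hA.clm_apply hy).mono (Icc_subset_Icc_right ht.2)

theorem intervalIntegrable_of_mem_Icc {E : Type*} [NormedAddCommGroup E] {b : ℝ → E}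
    (hb : IntervalIntegrable b volume a c) {t : ℝ} (ht : t ∈ Icc a c) :
    IntervalIntegrable b volume a t :=
  hb.mono_set (uIcc_subset_uIcc left_mem_uIcc (by rwa [uIcc_of_le (ht.1.trans ht.2)]))

/-- Global existence by the contraction principle: in terms of `v s = e^{-l (s - a)} y s`, with `l`
larger than a bound `M` of `‖A‖`, the integral equation is a fixed point equation with contraction
constant `M / l`. -/
theorem exists_isLinearTrajectory (hac : a ≤ c) (hA : ContinuousOn A (Icc a c)) {b : ℝ → Vec n}
    (hb : IntervalIntegrable b volume a c) (x₀ : Vec n) :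
    ∃ y, IsLinearTrajectory A b a c x₀ y := by
  set π : ℝ → Icc a c := projIcc a c hac with hπ
  have hπc : Continuous π := continuous_projIcc
  have hAc : Continuous fun s => A (π s) := hA.domRestrict.comp hπc
  obtain ⟨M, hM0, hM⟩ : ∃ M, 0 ≤ M ∧ ∀ s, ‖A (π s)‖ ≤ M := by
    obtain ⟨M, hM⟩ := isCompact_Icc.exists_bound_of_continuousOn hA
    exact ⟨M, (norm_nonneg _).trans (hM _ (π a).2), fun s => hM _ (π s).2⟩
  set l : ℝ := M + 1 with hl
  have hlpos : 0 < l := by positivity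
  set I : C(Icc a c, Vec n) → ℝ → Vec n := fun v t =>
    ∫ s in a..t, Real.exp (l * (s - a)) • A (π s) (v (π s)) with hI
  have hcont : ∀ v : C(Icc a c, Vec n),
      Continuous fun s => Real.exp (l * (s - a)) • A (π s) (v (π s)) := fun v =>
    Continuous.smul (f := fun s => Real.exp (l * (s - a))) (by fun_prop)
      (hAc.clm_apply (v.continuous.comp hπc))
  have hIc : ∀ v, Continuous (I v) := fun v =>
    intervalIntegral.continuous_primitive (fun _ _ => (hcont v).intervalIntegrable _ _) a
  have hbc : ContinuousOn (fun t => ∫ s in a..t, b s) (Icc a c) := by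
    have := intervalIntegral.continuousOn_primitive_interval' hb left_mem_uIcc
    rwa [uIcc_of_le hac] at this
  let T : C(Icc a c, Vec n) → C(Icc a c, Vec n) := fun v =>
    ⟨fun t => Real.exp (-(l * (t - a))) • (x₀ + (∫ s in a..t, b s) + I v t),
      Continuous.smul (f := fun t : Icc a c => Real.exp (-(l * (t - a)))) (by fun_prop)
        ((continuous_const.add hbc.domRestrict).add
        ((hIc v).comp continuous_subtype_val))⟩
  obtain ⟨q, hq⟩ : ∃ q : ℝ≥0, (q : ℝ) = M / l := 
    ⟨Real.toNNReal _, Real.coe_toNNReal _ (by positivity)⟩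
  have hT : ContractingWith q T := by
    refine ⟨?_, LipschitzWith.of_dist_le_mul fun v w => ?_⟩
    · rw [← NNReal.coe_lt_coe, hq, NNReal.coe_one, div_lt_one hlpos]
      linarith
    · rw [hq]
      rw [ContinuousMap.dist_le (by positivity)]
      intro t
      have h1 : T v t - T w t = Real.exp (-(l * (t - a))) • (I v t - I w t) := by
        simp only [T, ContinuousMap.coe_mk]
        rw [← smul_sub, add_sub_add_left_eq_sub]
      have h2 : ‖I v t - I w t‖
          ≤ ∫ s in a..t, Real.exp (l * (s - a)) * (M * dist v w) := by
        simp only [hI]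
        rw [← intervalIntegral.integral_sub ((hcont v).intervalIntegrable _ _)
          ((hcont w).intervalIntegrable _ _)]
        refine intervalIntegral.norm_integral_le_of_norm_le t.2.1 (ae_of_all _ fun s _ => ?_)
          (Continuous.intervalIntegrable (by fun_prop) _ _)
        rw [← smul_sub, ← map_sub, norm_smul, Real.norm_of_nonneg (Real.exp_pos _).le]
        gcongr
        refine (ContinuousLinearMap.le_opNorm _ _).trans ?_
        gcongr
        · exact hM s
        · rw [← dist_eq_norm]
          exact ContinuousMap.dist_apply_le_dist _
      have h3 : ∫ s in a..(t : ℝ), Real.exp (l * (s - a)) * (M * dist v w)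
          = (Real.exp (l * (t - a)) - 1) / l * (M * dist v w) := by
        rw [intervalIntegral.integral_mul_const]
        congr 1
        rw [intervalIntegral.integral_eq_sub_of_hasDerivAt
          (f := fun s => Real.exp (l * (s - a)) / l) (fun s _ => ?_)
          (Continuous.intervalIntegrable (by fun_prop) _ _)]
        · simp [sub_div]
        · have := (((hasDerivAt_id s).sub_const a).const_mul l).exp.div_const l
          refine this.congr_deriv ?_
          simp only [id]
          field_simp
      rw [dist_eq_norm, h1, norm_smul, Real.norm_of_nonneg (Real.exp_pos _).le]
      calc Real.exp (-(l * (t - a))) * ‖I v t - I w t‖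
          ≤ Real.exp (-(l * (t - a))) *
            (Real.exp (l * (t - a)) / l * (M * dist v w)) := by
              gcongr
              refine h2.trans (h3.le.trans ?_)
              gcongr
              linarith
        _ = Real.exp (-(l * (t - a))) * Real.exp (l * (t - a)) * (M / l * dist v w) := by ring
        _ = M / l * dist v w := by rw [← Real.exp_add, neg_add_cancel, Real.exp_zero, one_mul]
  obtain ⟨v, hv⟩ : ∃ v, T v = v := by
    have : Nonempty C(Icc a c, Vec n) := ⟨0⟩
    exact ⟨_, hT.fixedPoint_isFixedPt⟩
  refine ⟨fun t => Real.exp (l * (t - a)) • v (π t),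
    (Continuous.smul (f := fun t => Real.exp (l * (t - a))) (by fun_prop)
      (v.continuous.comp hπc)).continuousOn, fun t ht => ?_⟩
  have hπt : ∀ s ∈ Icc a c, (π s : ℝ) = s := fun s hs => by rw [hπ, projIcc_of_mem hac hs]
  have h1 : v (π t) = Real.exp (-(l * (t - a))) • (x₀ + (∫ s in a..t, b s) + I v t) := by
    conv_lhs => rw [← hv]
    simp only [T, ContinuousMap.coe_mk]
    rw [hπt t ht]
  have h2 : I v t = ∫ s in a..t, A s (Real.exp (l * (s - a)) • v (π s)) := by
    refine intervalIntegral.integral_congr fun s hs => ?_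
    rw [uIcc_of_le ht.1] at hs
    rw [hπt s ⟨hs.1, hs.2.trans ht.2⟩, map_smul]
  simp only
  rw [intervalIntegral.integral_add _ (intervalIntegrable_of_mem_Icc hb ht), ← h2, h1, smul_smul,
    ← Real.exp_add, add_neg_cancel, Real.exp_zero, one_smul]
  · abel
  · exact intervalIntegrable_apply_trajectory hA
      (Continuous.smul (f := fun t => Real.exp (l * (t - a))) (by fun_prop)
        (v.continuous.comp hπc)).continuousOn ht

theorem IsLinearTrajectory.linear_combination (hA : ContinuousOn A (Icc a c))
    {b₁ b₂ : ℝ → Vec n} (hb₁ : IntervalIntegrable b₁ volume a c)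
    (hb₂ : IntervalIntegrable b₂ volume a c) {x₁ x₂ : Vec n} {y₁ y₂ : ℝ → Vec n}
    (h₁ : IsLinearTrajectory A b₁ a c x₁ y₁) (h₂ : IsLinearTrajectory A b₂ a c x₂ y₂) (p q : ℝ) :
    IsLinearTrajectory A (fun s => p • b₁ s + q • b₂ s) a c (p • x₁ + q • x₂)
      (fun s => p • y₁ s + q • y₂ s) := by
  refine ⟨(h₁.1.const_smul p).add (h₂.1.const_smul q), fun t ht => ?_⟩
  have hi₁ := (intervalIntegrable_apply_trajectory hA h₁.1 ht).add
    (intervalIntegrable_of_mem_Icc hb₁ ht)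
  have hi₂ := (intervalIntegrable_apply_trajectory hA h₂.1 ht).add
    (intervalIntegrable_of_mem_Icc hb₂ ht)
  have h3 : ∀ s, A s (p • y₁ s + q • y₂ s) + (p • b₁ s + q • b₂ s)
      = p • (A s (y₁ s) + b₁ s) + q • (A s (y₂ s) + b₂ s) := fun s => by
    rw [map_add, map_smul, map_smul]
    module
  simp only [h3]
  rw [intervalIntegral.integral_add (f := fun s => p • (A s (y₁ s) + b₁ s))
    (g := fun s => q • (A s (y₂ s) + b₂ s)) (hi₁.smul p) (hi₂.smul q),
    intervalIntegral.integral_smul, intervalIntegral.integral_smul, h₁.2 t ht, h₂.2 t ht]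
  module

/-- Uniqueness: the difference of two solutions solves the homogeneous equation with initial value
`0`, and vanishes by Grönwall's inequality. -/
theorem IsLinearTrajectory.unique (hA : ContinuousOn A (Icc a c))
    {b : ℝ → Vec n} (hb : IntervalIntegrable b volume a c) {x₀ : Vec n} {y₁ y₂ : ℝ → Vec n}
    (h₁ : IsLinearTrajectory A b a c x₀ y₁) (h₂ : IsLinearTrajectory A b a c x₀ y₂) {t : ℝ}
    (ht : t ∈ Icc a c) : y₁ t = y₂ t := by
  have hd := h₁.linear_combination hA hb hb h₂ 1 (-1)
  set d : ℝ → Vec n := fun s => (1 : ℝ) • y₁ s + (-1 : ℝ) • y₂ s with hd_def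
  have hint : ∀ s ∈ Icc a c, d s = ∫ τ in a..s, A τ (d τ) := fun s hs => by
    rw [hd.2 s hs]
    simp
  have hAd : ContinuousOn (fun s => A s (d s)) (Icc a c) := hA.clm_apply hd.1
  obtain ⟨M, hM⟩ := isCompact_Icc.exists_bound_of_continuousOn hA
  have key := norm_le_gronwallBound_of_norm_deriv_right_le (f := d) (f' := fun s => A s (d s))
    (δ := 0) (K := M) (ε := 0) (a := a) (b := c) hd.1 (fun s hs => by
      have hs' := Ico_subset_Icc_self hs
      have hac : a < c := hs.1.trans_lt hs.2
      have h3 : HasDerivWithinAt (fun u => ∫ τ in a..u, A τ (d τ)) (A s (d s)) (Icc a c) s := by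
        have : Fact (s ∈ Icc a c) := ⟨hs'⟩
        exact intervalIntegral.integral_hasDerivWithinAt_right
          (intervalIntegrable_apply_trajectory hA hd.1 hs')
          (hAd.stronglyMeasurableAtFilter_nhdsWithin measurableSet_Icc s) (hAd s hs')
      have h4 : HasDerivWithinAt d (A s (d s)) (Icc a c) s :=
        h3.congr (fun u hu => hint u hu) (hint s hs')
      exact h4.mono_of_mem_nhdsWithin (Icc_mem_nhdsGE_of_mem hs))
    (by
      rcases le_or_gt a c with hac | hac
      · rw [hint a (left_mem_Icc.2 hac)]; simp
      · exact absurd (ht.1.trans ht.2) (not_le.2 hac))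
    (fun s hs => by
      rw [add_zero]
      exact (ContinuousLinearMap.le_opNorm _ _).trans
        (mul_le_mul_of_nonneg_right (hM s (Ico_subset_Icc_self hs)) (norm_nonneg _))) t ht
  rw [gronwallBound_ε0_δ0] at key
  have h5 : d t = 0 := norm_le_zero_iff.1 key
  simp only [hd_def, one_smul, neg_smul] at h5
  exact add_neg_eq_zero.1 h5

theorem isLinearTrajectory_ivpSolution (hac : a ≤ c) (hA : ContinuousOn A (Icc a c))
    {b : ℝ → Vec n} (hb : IntervalIntegrable b volume a c) (x₀ : Vec n) :
    IsLinearTrajectory A b a c x₀ (ivpSolution A b a c x₀) :=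
  Classical.epsilon_spec (exists_isLinearTrajectory hac hA hb x₀)

theorem ivpSolution_linear_combination (hac : a ≤ c) (hA : ContinuousOn A (Icc a c))
    {b₁ b₂ : ℝ → Vec n} (hb₁ : IntervalIntegrable b₁ volume a c)
    (hb₂ : IntervalIntegrable b₂ volume a c) (x₁ x₂ : Vec n) (p q : ℝ) {t : ℝ}
    (ht : t ∈ Icc a c) :
    ivpSolution A (fun s => p • b₁ s + q • b₂ s) a c (p • x₁ + q • x₂) t
      = p • ivpSolution A b₁ a c x₁ t + q • ivpSolution A b₂ a c x₂ t := by
  have hb : IntervalIntegrable (fun s => p • b₁ s + q • b₂ s) volume a c :=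
    (hb₁.smul p).add (hb₂.smul q)
  exact (isLinearTrajectory_ivpSolution hac hA hb _).unique hA hb
    ((isLinearTrajectory_ivpSolution hac hA hb₁ x₁).linear_combination hA hb₁ hb₂
      (isLinearTrajectory_ivpSolution hac hA hb₂ x₂) p q) ht

end LinearODE

/-! ### Integral functionals -/

/-- `f` is bounded and (almost everywhere strongly) measurable on `[a, b]`. -/
def BoundedMeasurableOn {F : Type*} [NormedAddCommGroup F] (f : ℝ → F) (a b : ℝ) : Prop :=
  AEStronglyMeasurable f (volume.restrict (Icc a b)) ∧ ∃ C, ∀ t ∈ Icc a b, ‖f t‖ ≤ C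

namespace BoundedMeasurableOn

variable {E F : Type*} [NormedAddCommGroup E] [NormedAddCommGroup F] {a b : ℝ}

theorem of_continuousOn {f : ℝ → F} (hf : ContinuousOn f (Icc a b)) :
    BoundedMeasurableOn f a b :=
  ⟨hf.aestronglyMeasurable measurableSet_Icc, isCompact_Icc.exists_bound_of_continuousOn hf⟩

theorem mono {f : ℝ → F} (hf : BoundedMeasurableOn f a b) {a' b' : ℝ} (ha : a ≤ a')
    (hb : b' ≤ b) : BoundedMeasurableOn f a' b' :=
  ⟨hf.1.mono_set (Icc_subset_Icc ha hb),
    hf.2.imp fun _ hC t ht => hC t (Icc_subset_Icc ha hb ht)⟩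

theorem congr {f g : ℝ → F} (hf : BoundedMeasurableOn f a b) (h : ∀ t ∈ Icc a b, f t = g t) :
    BoundedMeasurableOn g a b :=
  ⟨hf.1.congr ((ae_restrict_iff' measurableSet_Icc).2 (ae_of_all _ h)),
    hf.2.imp fun _ hC t ht => h t ht ▸ hC t ht⟩

theorem add {f g : ℝ → F} (hf : BoundedMeasurableOn f a b) (hg : BoundedMeasurableOn g a b) :
    BoundedMeasurableOn (fun t => f t + g t) a b := by
  obtain ⟨hf1, C, hC⟩ := hf
  obtain ⟨hg1, C', hC'⟩ := hg
  exact ⟨hf1.add hg1, C + C', fun t ht => (norm_add_le _ _).trans (add_le_add (hC t ht) (hC' t ht))⟩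

theorem intervalIntegrable {f : ℝ → F} (hab : a ≤ b) (hf : BoundedMeasurableOn f a b) :
    IntervalIntegrable f volume a b := by
  obtain ⟨hf1, C, hC⟩ := hf
  rw [intervalIntegrable_iff_integrableOn_Icc_of_le hab]
  exact IntegrableOn.of_bound (by simp) hf1 C
    ((ae_restrict_iff' measurableSet_Icc).2 (ae_of_all _ hC))

/-- Substitution into a map that is continuous on `[a, b] × E`; outside `[a, b]` its first argument
is clamped to get a globally continuous map. -/
theorem comp_continuousOn [NormedSpace ℝ E] [FiniteDimensional ℝ E]
    (hab : a ≤ b) {f : ℝ × E → F}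
    (hf : ContinuousOn f (Icc a b ×ˢ univ)) {p : ℝ → E} (hp : BoundedMeasurableOn p a b) :
    BoundedMeasurableOn (fun t => f (t, p t)) a b := by
  obtain ⟨hp1, C, hC⟩ := hp
  constructor
  · have hc : Continuous fun q : ℝ × E => f (projIcc a b hab q.1, q.2) :=
      hf.comp_continuous (((continuous_subtype_val.comp continuous_projIcc).comp
        continuous_fst).prodMk continuous_snd) fun q => ⟨(projIcc a b hab q.1).2, mem_univ _⟩
    refine (hc.comp_aestronglyMeasurable
      (continuous_id.aestronglyMeasurable.prodMk hp1)).congr ?_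
    refine (ae_restrict_iff' measurableSet_Icc).2 (ae_of_all _ fun t ht => ?_)
    simp [projIcc_of_mem hab ht]
  · have := ProperSpace.of_locallyCompactSpace ℝ (E := E)
    obtain ⟨C', hC'⟩ := (isCompact_Icc.prod (isCompact_closedBall (0 : E) C))
      |>.exists_bound_of_continuousOn (hf.mono (prod_mono_right (subset_univ _)))
    exact ⟨C', fun t ht => hC' _ ⟨ht, mem_closedBall_zero_iff.2 (hC t ht)⟩⟩

theorem const (x : F) : BoundedMeasurableOn (fun _ => x) a b := of_continuousOn continuousOn_const

theorem sum {ι : Type*} (s : Finset ι) {f : ι → ℝ → F}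
    (hf : ∀ i ∈ s, BoundedMeasurableOn (f i) a b) :
    BoundedMeasurableOn (fun t => ∑ i ∈ s, f i t) a b := by
  classical
  induction s using Finset.induction_on with
  | empty => simpa using const (0 : F)
  | insert i s hi ih =>
    simp only [Finset.sum_insert hi]
    exact (hf i (Finset.mem_insert_self i s)).add
      (ih fun j hj => hf j (Finset.mem_insert_of_mem hj))

variable [NormedSpace ℝ E] [NormedSpace ℝ F]

theorem clm_apply {A : ℝ → E →L[ℝ] F} {f : ℝ → E} (hA : BoundedMeasurableOn A a b)
    (hf : BoundedMeasurableOn f a b) : BoundedMeasurableOn (fun t => A t (f t)) a b := by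
  obtain ⟨hA1, C, hC⟩ := hA
  obtain ⟨hf1, C', hC'⟩ := hf
  refine ⟨isBoundedBilinearMap_apply.continuous.comp_aestronglyMeasurable (hA1.prodMk hf1),
    C * C', fun t ht => ?_⟩
  exact (ContinuousLinearMap.le_opNorm _ _).trans
    (mul_le_mul (hC t ht) (hC' t ht) (norm_nonneg _) ((norm_nonneg _).trans (hC t ht)))

theorem clm_comp {f : ℝ → E} (hf : BoundedMeasurableOn f a b) (A : E →L[ℝ] F) :
    BoundedMeasurableOn (fun t => A (f t)) a b :=
  (const A).clm_apply hf

theorem prodMk {f : ℝ → E} {g : ℝ → F} (hf : BoundedMeasurableOn f a b)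
    (hg : BoundedMeasurableOn g a b) : BoundedMeasurableOn (fun t => (f t, g t)) a b := by
  simpa using (hf.clm_comp (ContinuousLinearMap.inl ℝ E F)).add
    (hg.clm_comp (ContinuousLinearMap.inr ℝ E F))

/-- On a finite-dimensional space, a family of linear maps is bounded and measurable if its values
at each vector are. -/
theorem of_clm_apply [FiniteDimensional ℝ E] {A : ℝ → E →L[ℝ] F}
    (hA : ∀ z, BoundedMeasurableOn (fun t => A t z) a b) : BoundedMeasurableOn A a b := by
  set e := Module.finBasis ℝ E
  have h : A = fun t => ∑ i, ContinuousLinearMap.smulRightL ℝ E F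
      (LinearMap.toContinuousLinearMap (e.coord i)) (A t (e i)) := by
    funext t
    ext z
    conv_lhs => rw [← e.sum_repr z, map_sum]
    simp
  rw [h]
  exact sum _ fun i _ => (hA (e i)).clm_comp _

end BoundedMeasurableOn

section IntegralFunctional

variable {E V : Type*} [NormedAddCommGroup E] [NormedSpace ℝ E] [NormedAddCommGroup V]
  [NormedSpace ℝ V] [FiniteDimensional ℝ V] {a b : ℝ}

/-- Differentiation under the integral sign, for an integrand that is continuously differentiable
in a family of affine maps that is only bounded and measurable in time. -/
theorem differentiable_integral_comp_affine (hab : a < b) {f : ℝ → V → ℝ}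
    (hf : ContDiffOn ℝ 1 (fun q : ℝ × V => f q.1 q.2) (Icc a b ×ˢ univ))
    {p₀ : ℝ → V} {P : ℝ → E →L[ℝ] V} (hp₀ : BoundedMeasurableOn p₀ a b)
    (hP : BoundedMeasurableOn P a b) :
    Differentiable ℝ fun z => ∫ s in a..b, f s (p₀ s + P s z) := by
  intro z₀
  have hu : UniqueDiffOn ℝ (Icc a b ×ˢ (univ : Set V)) :=
    (uniqueDiffOn_Icc hab).prod uniqueDiffOn_univ
  set f' : ℝ × V → V →L[ℝ] ℝ := fun q =>
    (fderivWithin ℝ (fun q : ℝ × V => f q.1 q.2) (Icc a b ×ˢ univ) q).comp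
      (ContinuousLinearMap.inr ℝ ℝ V) with hf'
  have hf'c : ContinuousOn f' (Icc a b ×ˢ univ) :=
    (hf.continuousOn_fderivWithin hu le_rfl).clm_comp continuousOn_const
  have hder : ∀ s ∈ Icc a b, ∀ v, HasFDerivAt (f s) (f' (s, v)) v := fun s hs v => by
    have h1 := (hf.differentiableOn one_ne_zero (s, v) ⟨hs, mem_univ _⟩).hasFDerivWithinAt
    rw [← hasFDerivWithinAt_univ]
    exact HasFDerivWithinAt.comp (f := fun v => (s, v)) v h1
      (hasFDerivAt_prodMk_right s v).hasFDerivWithinAt fun w _ => ⟨hs, mem_univ _⟩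
  have hp : ∀ z, BoundedMeasurableOn (fun s => p₀ s + P s z) a b := fun z =>
    hp₀.add (hP.clm_apply (.const z))
  have hF : ∀ z, BoundedMeasurableOn (fun s => f s (p₀ s + P s z)) a b := fun z =>
    (hp z).comp_continuousOn hab.le hf.continuousOn
  have hF' : AEStronglyMeasurable (fun s => (f' (s, p₀ s + P s z₀)).comp (P s))
      (volume.restrict (Icc a b)) :=
    (isBoundedBilinearMap_comp (𝕜 := ℝ) (E := E) (F := V) (G := ℝ)).continuous
      |>.comp_aestronglyMeasurable (((hp z₀).comp_continuousOn hab.le hf'c).1.prodMk hP.1)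
  have hι : uIoc a b ⊆ Icc a b := by rw [uIoc_of_le hab.le]; exact Ioc_subset_Icc_self
  obtain ⟨C₀, hC₀⟩ := hp₀.2
  obtain ⟨C₁, hC₁⟩ := hP.2
  obtain ⟨C, hC⟩ := (isCompact_Icc.prod
      (isCompact_closedBall (0 : V) (C₀ + C₁ * (‖z₀‖ + 1)))).exists_bound_of_continuousOn
    (hf'c.mono (prod_mono_right (subset_univ _)))
  refine (intervalIntegral.hasFDerivAt_integral_of_dominated_of_fderiv_le
    (F := fun z s => f s (p₀ s + P s z))
    (F' := fun z s => (f' (s, p₀ s + P s z)).comp (P s)) (bound := fun _ => C * C₁)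
    (Metric.ball_mem_nhds z₀ one_pos) (Eventually.of_forall fun z => (hF z).1.mono_set hι)
    ((hF z₀).intervalIntegrable hab.le) (hF'.mono_set hι) ?_
    intervalIntegrable_const ?_).differentiableAt
  · refine ae_of_all _ fun s hs z hz => ?_
    have hs := hι hs
    refine (ContinuousLinearMap.opNorm_comp_le _ _).trans ?_
    have hball : p₀ s + P s z ∈ Metric.closedBall (0 : V) (C₀ + C₁ * (‖z₀‖ + 1)) := by
      rw [mem_closedBall_zero_iff]
      refine (norm_add_le _ _).trans (add_le_add (hC₀ s hs) ?_)
      have hz' : ‖z‖ ≤ ‖z₀‖ + 1 := by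
        have := norm_le_norm_add_norm_sub z₀ z
        rw [Metric.mem_ball, dist_eq_norm] at hz
        linarith [norm_sub_rev z₀ z]
      exact (ContinuousLinearMap.le_opNorm _ _).trans
        (mul_le_mul (hC₁ s hs) hz' (norm_nonneg _) ((norm_nonneg _).trans (hC₁ s hs)))
    have hbound := hC (s, p₀ s + P s z) ⟨hs, hball⟩
    exact mul_le_mul hbound (hC₁ s hs) (norm_nonneg _) ((norm_nonneg _).trans hbound)
  · refine ae_of_all _ fun s hs z _ => ?_
    exact (hder s (hι hs) _).comp z ((P s).hasFDerivAt.const_add (p₀ s))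

theorem convexOn_integral_comp_affine (hab : a ≤ b) {f : ℝ → V → ℝ}
    (hf : ContinuousOn (fun q : ℝ × V => f q.1 q.2) (Icc a b ×ˢ univ))
    (hconv : ∀ s ∈ Icc a b, ConvexOn ℝ univ (f s))
    {p₀ : ℝ → V} {P : ℝ → E →L[ℝ] V} (hp₀ : BoundedMeasurableOn p₀ a b)
    (hP : BoundedMeasurableOn P a b) :
    ConvexOn ℝ univ fun z => ∫ s in a..b, f s (p₀ s + P s z) := by
  have hF : ∀ z, IntervalIntegrable (fun s => f s (p₀ s + P s z)) volume a b := fun z =>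
    ((hp₀.add (hP.clm_apply (.const z))).comp_continuousOn hab hf).intervalIntegrable hab
  refine ⟨convex_univ, fun y _ z _ u v hu hv huv => ?_⟩
  simp only [smul_eq_mul]
  rw [← intervalIntegral.integral_const_mul, ← intervalIntegral.integral_const_mul,
    ← intervalIntegral.integral_add ((hF y).const_mul u) ((hF z).const_mul v)]
  refine intervalIntegral.integral_mono_on hab (hF _)
    (((hF y).const_mul u).add ((hF z).const_mul v)) fun s hs => ?_
  have h1 : p₀ s + P s (u • y + v • z) = u • (p₀ s + P s y) + v • (p₀ s + P s z) := by
    obtain rfl : u = 1 - v := by linarith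
    rw [map_add, map_smul, map_smul]
    module
  rw [h1]
  exact (hconv s hs).2 (mem_univ _) (mem_univ _) hu hv huv

end IntegralFunctional

/-! ### Piecewise polynomials and the squared positive part -/

section PiecewisePolynomial

theorem PiecewisePolynomialOn.boundedMeasurableOn {φ : ℝ → ℝ} {a b : ℝ}
    (h : PiecewisePolynomialOn φ a b) : BoundedMeasurableOn φ a b := by
  obtain ⟨m, s, hs, hs0, hsm, hp⟩ := h
  have hcover : Icc a b ⊆ (⋃ i : Fin m, Ioo (s i.castSucc) (s i.succ)) ∪ range s := fun t ht => by
    by_contra hcon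
    simp only [mem_union, mem_iUnion, not_or, not_exists, mem_range] at hcon
    -- Off the breakpoints and the open pieces, every breakpoint would lie below `t`.
    have hlt : ∀ i : Fin (m + 1), s i < t := fun i => by
      induction i using Fin.induction with
      | zero => exact (hs0 ▸ ht.1).lt_of_ne (hcon.2 0)
      | succ i ih => exact (not_lt.1 fun h => hcon.1 i ⟨ih, h⟩).lt_of_ne (hcon.2 _)
    exact absurd (hsm ▸ hlt (Fin.last m)) (not_lt.2 ht.2)
  constructor
  · refine AEStronglyMeasurable.mono_set hcover ?_
    rw [aestronglyMeasurable_union_iff, aestronglyMeasurable_iUnion_iff]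
    refine ⟨fun i => ?_, ?_⟩
    · obtain ⟨p, hp⟩ := hp i
      exact (p.continuous.aestronglyMeasurable).congr
        ((ae_restrict_iff' measurableSet_Ioo).2 (ae_of_all _ fun t ht => (hp t ht).symm))
    · have h0 : volume.restrict (range s) = 0 :=
        Measure.restrict_eq_zero.2 ((finite_range s).measure_zero _)
      rw [h0]
      exact aestronglyMeasurable_zero_measure φ
  · have hbdd : Bornology.IsBounded (φ '' Icc a b) := by
      refine Bornology.IsBounded.subset ?_ (image_mono hcover)
      rw [image_union, image_iUnion]
      refine Bornology.IsBounded.union ((Bornology.isBounded_iUnion).2 fun i => ?_)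
        ((finite_range s).image φ).isBounded
      obtain ⟨p, hp⟩ := hp i
      rw [image_congr hp]
      exact (isCompact_Icc.image p.continuous).isBounded.subset (image_mono Ioo_subset_Icc_self)
    obtain ⟨C, hC⟩ := hbdd.exists_norm_le
    exact ⟨C, fun t ht => hC _ (mem_image_of_mem φ ht)⟩

end PiecewisePolynomial

theorem contDiff_max_zero_sq : ContDiff ℝ 1 fun x : ℝ => max 0 x ^ 2 := by
  have hder : ∀ x : ℝ, HasDerivAt (fun x : ℝ => max 0 x ^ 2) (2 * max 0 x) x := fun x => by
    rcases lt_trichotomy x 0 with hx | rfl | hx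
    · rw [max_eq_left hx.le, mul_zero]
      refine (hasDerivAt_const x (0 : ℝ)).congr_of_eventuallyEq ?_
      filter_upwards [Iio_mem_nhds hx] with y hy
      rw [max_eq_left (le_of_lt hy)]
      simp
    · rw [hasDerivAt_iff_isLittleO]
      have h1 : (fun y : ℝ => y ^ 2) =o[𝓝 0] fun y : ℝ => y := by
        simpa using (Asymptotics.isLittleO_pow_pow (𝕜 := ℝ) one_lt_two)
      simp only [max_self, mul_zero, smul_zero, sub_zero, ne_eq, OfNat.ofNat_ne_zero,
        not_false_eq_true, zero_pow]
      refine Asymptotics.IsBigO.trans_isLittleO (Asymptotics.IsBigO.of_bound 1 ?_) h1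
      refine Eventually.of_forall fun y => ?_
      rw [one_mul, norm_pow, norm_pow]
      gcongr
      rcases le_total y 0 with hy | hy <;> simp [hy]
    · rw [max_eq_right hx.le]
      refine HasDerivAt.congr_of_eventuallyEq (f := fun y => y ^ 2) ?_ ?_
      · simpa using hasDerivAt_pow 2 x
      · filter_upwards [Ioi_mem_nhds hx] with y hy
        rw [max_eq_right (le_of_lt hy)]
  rw [contDiff_one_iff_deriv]
  refine ⟨fun x => (hder x).differentiableAt, ?_⟩
  rw [funext fun x => (hder x).deriv]
  fun_prop

/-! ### The discretized optimal control problem -/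

/-- A shortcut: the generic search for this instance unfolds the nested products. -/
instance (nx nu Nu K : ℕ) : ContinuousSMul ℝ (DecVec nx nu Nu K) := IsBoundedSMul.continuousSMul

theorem convexOn_finset_sum {E ι : Type*} [AddCommGroup E] [Module ℝ E] {s : Set E}
    (hs : Convex ℝ s) (I : Finset ι) {f : ι → E → ℝ} (hf : ∀ i ∈ I, ConvexOn ℝ s (f i)) :
    ConvexOn ℝ s fun z => ∑ i ∈ I, f i z := by
  classical
  induction I using Finset.induction_on with
  | empty => simpa using convexOn_const (0 : ℝ) hs
  | insert i I hi ih =>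
    simp only [Finset.sum_insert hi]
    exact (hf i (Finset.mem_insert_self i I)).add
      (ih fun j hj => hf j (Finset.mem_insert_of_mem hj))

theorem ConvexOn.max_zero_sq {E : Type*} [AddCommGroup E] [Module ℝ E] {s : Set E} {f : E → ℝ}
    (hf : ConvexOn ℝ s f) : ConvexOn ℝ s fun z => max 0 (f z) ^ 2 := by
  have h : ConvexOn ℝ s fun z => max 0 (f z) := (convexOn_const (0 : ℝ) hf.1).sup hf
  exact h.pow (fun z _ => le_max_left _ _) 2

namespace ConvexOCP

variable {nx nu Nu K ng nh nP nQ : ℕ} (D : ConvexOCP nx nu Nu K ng nh nP nQ)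

theorem node_lt (k : Fin K) : D.t k.castSucc < D.t k.succ := D.t_strictMono k.castSucc_lt_succ

theorem first_le_node (k : Fin (K + 1)) : D.t 0 ≤ D.t k := D.t_strictMono.monotone (Fin.zero_le k)

theorem node_le_last (k : Fin (K + 1)) : D.t k ≤ D.t (Fin.last K) :=
  D.t_strictMono.monotone (Fin.le_last k)

theorem segment_subset (k : Fin K) :
    Icc (D.t k.castSucc) (D.t k.succ) ⊆ Icc (D.t 0) (D.t (Fin.last K)) :=
  Icc_subset_Icc (D.first_le_node _) (D.node_le_last _)

theorem continuousOn_A (k : Fin K) : ContinuousOn D.A (Icc (D.t k.castSucc) (D.t k.succ)) :=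
  D.A_contDiff.continuousOn.mono (D.segment_subset k)

theorem ctrl_linear_combination (p q : ℝ) (U W : CtrlVec nu Nu) (s : ℝ) :
    D.ctrl (p • U + q • W) s = p • D.ctrl U s + q • D.ctrl W s := by
  simp only [ctrl, Finset.smul_sum, ← Finset.sum_add_distrib]
  refine Finset.sum_congr rfl fun j _ => ?_
  rw [PiLp.add_apply, PiLp.smul_apply, PiLp.smul_apply]
  module

theorem boundedMeasurableOn_ctrl (k : Fin K) (U : CtrlVec nu Nu) :
    BoundedMeasurableOn (D.ctrl U) (D.t k.castSucc) (D.t k.succ) :=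
  .sum _ fun j _ => ((D.Γ_piecewise j).boundedMeasurableOn.mono (D.first_le_node _)
    (D.node_le_last _)).clm_comp ((ContinuousLinearMap.id ℝ ℝ).smulRight (U j))

theorem intervalIntegrable_B_ctrl (k : Fin K) (U : CtrlVec nu Nu) :
    IntervalIntegrable (fun s => D.B s (D.ctrl U s)) volume (D.t k.castSucc) (D.t k.succ) :=
  ((BoundedMeasurableOn.of_continuousOn (D.B_contDiff.continuousOn.mono
    (D.segment_subset k))).clm_apply (D.boundedMeasurableOn_ctrl k U)).intervalIntegrable
      (D.node_lt k).le

theorem intervalIntegrable_w (k : Fin K) :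
    IntervalIntegrable D.w volume (D.t k.castSucc) (D.t k.succ) :=
  (BoundedMeasurableOn.of_continuousOn (D.w_contDiff.continuousOn.mono
    (D.segment_subset k))).intervalIntegrable (D.node_lt k).le

theorem PhiX_linear_combination (k : Fin K) (p q : ℝ) (x y : Vec nx) {s : ℝ}
    (hs : s ∈ Icc (D.t k.castSucc) (D.t k.succ)) :
    D.PhiX k (p • x + q • y) s = p • D.PhiX k x s + q • D.PhiX k y s := by
  have h := ivpSolution_linear_combination (b₁ := fun _ => 0) (b₂ := fun _ => 0)
    (D.node_lt k).le (D.continuousOn_A k) intervalIntegrable_const intervalIntegrable_const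
    x y p q hs
  simpa only [PhiX, smul_zero, add_zero] using h

theorem PhiU_linear_combination (k : Fin K) (p q : ℝ) (U W : CtrlVec nu Nu) {s : ℝ}
    (hs : s ∈ Icc (D.t k.castSucc) (D.t k.succ)) :
    D.PhiU k (p • U + q • W) s = p • D.PhiU k U s + q • D.PhiU k W s := by
  have h := ivpSolution_linear_combination (D.node_lt k).le (D.continuousOn_A k)
    (D.intervalIntegrable_B_ctrl k U) (D.intervalIntegrable_B_ctrl k W) 0 0 p q hs
  simp only [smul_zero, add_zero] at h
  simpa only [PhiU, ctrl_linear_combination, map_add, map_smul] using h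

/-- The linear part of `z ↦ (x^k(s), ν(s))`, for `s` in the `k`-th time interval (and `0` for other
`s`). -/
def pathLin (k : Fin K) (s : ℝ) : DecVec nx nu Nu K →L[ℝ] Vec nx × Vec nu :=
  open Classical in
  if hs : s ∈ Icc (D.t k.castSucc) (D.t k.succ) then
    LinearMap.toContinuousLinearMap
      { toFun := fun z => (D.PhiX k (z.fst k.castSucc) s + D.PhiU k z.snd s, D.ctrl z.snd s)
        map_add' := fun y z => by
          have h1 := D.PhiX_linear_combination k 1 1 (y.fst k.castSucc) (z.fst k.castSucc) hs
          have h2 := D.PhiU_linear_combination k 1 1 y.snd z.snd hs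
          have h3 := D.ctrl_linear_combination 1 1 y.snd z.snd s
          simp only [one_smul] at h1 h2 h3
          rw [WithLp.add_fst, WithLp.add_snd, PiLp.add_apply, h1, h2, h3, Prod.mk_add_mk]
          congr 1
          abel
        map_smul' := fun p z => by
          have h1 := D.PhiX_linear_combination k p 0 (z.fst k.castSucc) 0 hs
          have h2 := D.PhiU_linear_combination k p 0 z.snd 0 hs
          have h3 := D.ctrl_linear_combination p 0 z.snd 0 s
          simp only [zero_smul, add_zero] at h1 h2 h3
          rw [WithLp.smul_fst, WithLp.smul_snd, PiLp.smul_apply, h1, h2, h3, ← smul_add]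
          rfl }
  else 0

theorem pathLin_apply (k : Fin K) {s : ℝ} (hs : s ∈ Icc (D.t k.castSucc) (D.t k.succ))
    (z : DecVec nx nu Nu K) : D.pathLin k s z
      = (D.PhiX k (z.fst k.castSucc) s + D.PhiU k z.snd s, D.ctrl z.snd s) := by
  rw [pathLin, dif_pos hs]
  rfl

theorem path_eq (k : Fin K) {s : ℝ} (hs : s ∈ Icc (D.t k.castSucc) (D.t k.succ))
    (z : DecVec nx nu Nu K) : (D.traj k (z.fst k.castSucc) z.snd s, D.ctrl z.snd s)
      = (D.phi k s, 0) + D.pathLin k s z := by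
  rw [pathLin_apply D k hs, traj, Prod.mk_add_mk, zero_add, add_comm (D.phi k s)]

theorem boundedMeasurableOn_phi (k : Fin K) :
    BoundedMeasurableOn (fun s => (D.phi k s, (0 : Vec nu))) (D.t k.castSucc) (D.t k.succ) :=
  (BoundedMeasurableOn.of_continuousOn (isLinearTrajectory_ivpSolution (D.node_lt k).le
    (D.continuousOn_A k) (D.intervalIntegrable_w k) 0).1).prodMk (.const 0)

theorem boundedMeasurableOn_pathLin (k : Fin K) :
    BoundedMeasurableOn (D.pathLin k) (D.t k.castSucc) (D.t k.succ) := by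
  refine .of_clm_apply fun z => ?_
  have h1 : ContinuousOn (D.PhiX k (z.fst k.castSucc)) (Icc (D.t k.castSucc) (D.t k.succ)) :=
    (isLinearTrajectory_ivpSolution (D.node_lt k).le (D.continuousOn_A k)
      intervalIntegrable_const _).1
  have h2 : ContinuousOn (D.PhiU k z.snd) (Icc (D.t k.castSucc) (D.t k.succ)) :=
    (isLinearTrajectory_ivpSolution (D.node_lt k).le (D.continuousOn_A k)
      (D.intervalIntegrable_B_ctrl k z.snd) _).1
  exact ((BoundedMeasurableOn.of_continuousOn (h1.add h2)).prodMk
    (D.boundedMeasurableOn_ctrl k z.snd)).congr fun s hs => (D.pathLin_apply k hs z).symm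

/-- The integrand of `ξ_k`. -/
def violation (s : ℝ) (p : Vec nx × Vec nu) : ℝ :=
  (∑ i, (max 0 (D.g s p i)) ^ 2) + ∑ j, (D.h s p j) ^ 2

theorem contDiffOn_violation :
    ContDiffOn ℝ 1 (fun q : ℝ × (Vec nx × Vec nu) => D.violation q.1 q.2)
      (Icc (D.t 0) (D.t (Fin.last K)) ×ˢ univ) := by
  refine ContDiffOn.add (ContDiffOn.sum fun i _ => ?_) (ContDiffOn.sum fun j _ => ?_)
  · exact contDiff_max_zero_sq.comp_contDiffOn (contDiffOn_pi.1 D.g_contDiff i)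
  · exact (contDiffOn_pi.1 D.h_contDiff j).pow 2

theorem convexOn_violation {s : ℝ} (hs : s ∈ Icc (D.t 0) (D.t (Fin.last K))) :
    ConvexOn ℝ univ (D.violation s) := by
  refine ConvexOn.add (convexOn_finset_sum convex_univ _ fun i _ => (D.g_convex s hs i).max_zero_sq)
    (convexOn_finset_sum convex_univ _ fun j _ => ?_)
  have h : ConvexOn ℝ univ fun x : ℝ => x ^ 2 := even_two.convexOn_pow
  exact h.comp_affineMap ((LinearMap.proj j : (Fin nh → ℝ) →ₗ[ℝ] ℝ).toAffineMap.comp (D.h s))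

theorem xi_eq (k : Fin K) : (fun z : DecVec nx nu Nu K => D.xi k (z.fst k.castSucc) z.snd)
    = fun z => ∫ s in (D.t k.castSucc)..(D.t k.succ),
        D.violation s ((D.phi k s, 0) + D.pathLin k s z) := by
  funext z
  refine intervalIntegral.integral_congr fun s hs => ?_
  rw [uIcc_of_le (D.node_lt k).le] at hs
  rw [← path_eq D k hs, violation]

theorem Yk_eq (k : Fin K) : (fun z : DecVec nx nu Nu K => D.Yk k (z.fst k.castSucc) z.snd)
    = fun z => ∫ s in (D.t k.castSucc)..(D.t k.succ),
        D.Y s ((D.phi k s, 0) + D.pathLin k s z) := by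
  funext z
  refine intervalIntegral.integral_congr fun s hs => ?_
  rw [uIcc_of_le (D.node_lt k).le] at hs
  rw [← path_eq D k hs]

theorem differentiable_xi (k : Fin K) :
    Differentiable ℝ fun z : DecVec nx nu Nu K => D.xi k (z.fst k.castSucc) z.snd := by
  rw [xi_eq]
  exact differentiable_integral_comp_affine (D.node_lt k)
    (D.contDiffOn_violation.mono (prod_mono_left (D.segment_subset k)))
    (D.boundedMeasurableOn_phi k) (D.boundedMeasurableOn_pathLin k)

theorem differentiable_Yk (k : Fin K) :
    Differentiable ℝ fun z : DecVec nx nu Nu K => D.Yk k (z.fst k.castSucc) z.snd := by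
  rw [Yk_eq]
  exact differentiable_integral_comp_affine (D.node_lt k)
    (D.Y_contDiff.mono (prod_mono_left (D.segment_subset k)))
    (D.boundedMeasurableOn_phi k) (D.boundedMeasurableOn_pathLin k)

theorem convexOn_xi (k : Fin K) :
    ConvexOn ℝ univ fun z : DecVec nx nu Nu K => D.xi k (z.fst k.castSucc) z.snd := by
  rw [xi_eq]
  exact convexOn_integral_comp_affine (D.node_lt k).le
    (D.contDiffOn_violation.continuousOn.mono (prod_mono_left (D.segment_subset k)))
    (fun s hs => D.convexOn_violation (D.segment_subset k hs))
    (D.boundedMeasurableOn_phi k) (D.boundedMeasurableOn_pathLin k)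

theorem convexOn_Yk (k : Fin K) :
    ConvexOn ℝ univ fun z : DecVec nx nu Nu K => D.Yk k (z.fst k.castSucc) z.snd := by
  rw [Yk_eq]
  exact convexOn_integral_comp_affine (D.node_lt k).le
    (D.Y_contDiff.continuousOn.mono (prod_mono_left (D.segment_subset k)))
    (fun s hs => D.Y_convex s (D.segment_subset k hs))
    (D.boundedMeasurableOn_phi k) (D.boundedMeasurableOn_pathLin k)

/-- The projection of `z = (X, U)` to the state at a node. -/
def nodeL (k : Fin (K + 1)) : DecVec nx nu Nu K →L[ℝ] Vec nx :=
  (PiLp.proj 2 (fun _ : Fin (K + 1) => Vec nx) k).comp (WithLp.fstL 2 ℝ _ _)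

theorem differentiable_terminal :
    Differentiable ℝ fun z : DecVec nx nu Nu K => D.L (z.fst (Fin.last K)) :=
  (D.L_contDiff.differentiable one_ne_zero).comp (nodeL (nu := nu) (Nu := Nu) _).differentiable

theorem convexOn_terminal :
    ConvexOn ℝ univ fun z : DecVec nx nu Nu K => D.L (z.fst (Fin.last K)) :=
  D.L_convex.comp_linearMap (nodeL (nu := nu) (Nu := Nu) (Fin.last K)).toLinearMap

theorem differentiable_runningCost : Differentiable ℝ fun z : DecVec nx nu Nu K =>
    ∑ k : Fin K, D.Yk k (z.fst k.castSucc) z.snd :=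
  Differentiable.fun_sum fun k _ => D.differentiable_Yk k

theorem convexOn_runningCost : ConvexOn ℝ univ fun z : DecVec nx nu Nu K =>
    ∑ k : Fin K, D.Yk k (z.fst k.castSucc) z.snd :=
  convexOn_finset_sum convex_univ _ fun k _ => D.convexOn_Yk k

theorem convexOn_objective : ConvexOn ℝ univ D.objective :=
  D.convexOn_terminal.add D.convexOn_runningCost

theorem continuous_objective : Continuous D.objective :=
  D.differentiable_terminal.continuous.add D.differentiable_runningCost.continuous

theorem eqResidual_eq (z : DecVec nx nu Nu K) : D.eqResidual z
    = (fun k => nodeL k.succ z - ((D.pathLin k (D.t k.succ) z).1 + D.phi k (D.t k.succ)),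
        D.Q (nodeL 0 z, nodeL (Fin.last K) z)) := by
  refine Prod.ext (funext fun k => ?_) rfl
  simp only [eqResidual]
  rw [D.pathLin_apply k (right_mem_Icc.2 (D.node_lt k).le)]
  rfl

theorem isClosed_Zset : IsClosed D.Zset := by
  have h1 : Continuous D.eqResidual := by
    rw [funext D.eqResidual_eq]
    refine Continuous.prodMk (continuous_pi fun k => ?_) ?_
    · fun_prop
    · exact D.Q.continuous_of_finiteDimensional.comp (by fun_prop)
  have h2 : Continuous fun z : DecVec nx nu Nu K => D.P (z.fst 0, z.fst (Fin.last K)) :=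
    D.P_contDiff.continuous.comp
      ((nodeL 0).continuous.prodMk (nodeL (nu := nu) (Nu := Nu) (Fin.last K)).continuous)
  have h3 : Continuous fun z : DecVec nx nu Nu K => z.snd := (WithLp.sndL 2 ℝ _ _).continuous
  have h4 : {z : DecVec nx nu Nu K | ∀ i, D.P (z.fst 0, z.fst (Fin.last K)) i ≤ 0}
      = ⋂ i, {z | D.P (z.fst 0, z.fst (Fin.last K)) i ≤ 0} := by ext; simp
  have h5 : IsClosed {z : DecVec nx nu Nu K | ∀ i, D.P (z.fst 0, z.fst (Fin.last K)) i ≤ 0} := by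
    rw [h4]
    exact isClosed_iInter fun i => isClosed_le ((continuous_apply i).comp h2) continuous_const
  exact (isClosed_eq h1 continuous_const).inter (h5.inter (D.Uset_compact.isClosed.preimage h3))

theorem convex_Zset : Convex ℝ D.Zset := by
  rintro y ⟨hy1, hy2, hy3⟩ z ⟨hz1, hz2, hz3⟩ a b ha hb hab
  refine ⟨?_, fun i => ?_, D.Uset_convex hy3 hz3 ha hb hab⟩
  · have h : D.eqResidual (a • y + b • z) = a • D.eqResidual y + b • D.eqResidual z := by
      simp only [eqResidual_eq]
      refine Prod.ext (funext fun k => ?_) ?_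
      · obtain rfl : a = 1 - b := by linarith
        simp only [map_add, map_smul, Prod.fst_add, Prod.smul_fst, Pi.add_apply, Pi.smul_apply]
        module
      · have := Convex.combo_affine_apply (f := D.Q) (x := (nodeL 0 y, nodeL (Fin.last K) y))
          (y := (nodeL 0 z, nodeL (Fin.last K) z)) hab
        simpa using this
    rw [h, hy1, hz1, smul_zero, smul_zero, add_zero]
  · have := (D.P_convex i).2 (mem_univ (y.fst 0, y.fst (Fin.last K)))
      (mem_univ (z.fst 0, z.fst (Fin.last K))) ha hb hab
    refine le_trans this ?_
    exact add_nonpos (mul_nonpos_of_nonneg_of_nonpos ha (hy2 i))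
      (mul_nonpos_of_nonneg_of_nonpos hb (hz2 i))

theorem StrongSlater.exists_mem_Zset {D : ConvexOCP nx nu Nu K ng nh nP nQ} {ε : ℝ}
    (h : D.StrongSlater ε) :
    ∃ z ∈ D.Zset, ∀ k : Fin K, D.xi k (z.fst k.castSucc) z.snd < ε := by
  obtain ⟨-, z, h1, h2, h3, h4⟩ := h
  exact ⟨z, ⟨h1, fun i => (h3 i).le, intrinsicInterior_subset h4⟩, h2⟩

end ConvexOCP

/-! ### The outer function -/

theorem outerH_mono {K : ℕ} {ζ η : CompVec K} (h0 : ζ.fst ≤ η.fst)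
    (h : ∀ k, ζ.snd k ≤ η.snd k) : outerH ζ ≤ outerH η :=
  add_le_add h0 (Finset.sum_le_sum fun k _ => max_le_max le_rfl (h k))

theorem convexOn_outerH (K : ℕ) : ConvexOn ℝ univ (outerH (K := K)) := by
  have h1 : ConvexOn ℝ univ fun ζ : CompVec K => ζ.fst :=
    (WithLp.fstL 2 ℝ ℝ (EuclideanSpace ℝ (Fin K))).toLinearMap.convexOn convex_univ
  refine h1.add (convexOn_finset_sum convex_univ _ fun k _ => ?_)
  have h2 : ConvexOn ℝ univ fun ζ : CompVec K => ζ.snd k :=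
    ((PiLp.proj (𝕜 := ℝ) 2 (fun _ : Fin K => ℝ) k).comp
      (WithLp.sndL 2 ℝ ℝ (EuclideanSpace ℝ (Fin K)))).toLinearMap.convexOn convex_univ
  exact (convexOn_const (0 : ℝ) convex_univ).sup h2

namespace ConvexOCP

variable {nx nu Nu K ng nh nP nQ : ℕ} (D : ConvexOCP nx nu Nu K ng nh nP nQ)

/-! ### The composite objective and its models -/

theorem differentiable_G (keepL : Bool) (ε γ : ℝ) : Differentiable ℝ (D.G keepL ε γ) := by
  have h1 : Differentiable ℝ fun z : DecVec nx nu Nu K =>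
      (if keepL then 0 else D.L (z.fst (Fin.last K)))
        + ∑ k : Fin K, D.Yk k (z.fst k.castSucc) z.snd := by
    refine Differentiable.add ?_ D.differentiable_runningCost
    cases keepL
    · exact D.differentiable_terminal
    · exact differentiable_const _
  have h2 : Differentiable ℝ fun z : DecVec nx nu Nu K =>
      (WithLp.toLp 2 fun k : Fin K => γ * (D.xi k (z.fst k.castSucc) z.snd - ε) :
        EuclideanSpace ℝ (Fin K)) :=
    differentiable_euclidean.2 fun k => ((D.differentiable_xi k).sub_const ε).const_mul γ
  exact (WithLp.prodContinuousLinearEquiv 2 ℝ ℝ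
    (EuclideanSpace ℝ (Fin K))).symm.differentiable.comp (h1.prodMk h2)

theorem convexOn_G_fst (keepL : Bool) (ε γ : ℝ) :
    ConvexOn ℝ univ fun z => (D.G keepL ε γ z).fst := by
  refine ConvexOn.add ?_ D.convexOn_runningCost
  cases keepL
  · exact D.convexOn_terminal
  · exact convexOn_const _ convex_univ

theorem convexOn_G_snd (keepL : Bool) (ε : ℝ) {γ : ℝ} (hγ : 0 ≤ γ) (k : Fin K) :
    ConvexOn ℝ univ fun z => (D.G keepL ε γ z).snd k :=
  ConvexOn.smul hγ ((D.convexOn_xi k).sub (concaveOn_const ε convex_univ))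

/-- The finite part of `J`. -/
def keptCost (keepL : Bool) (z : DecVec nx nu Nu K) : ℝ :=
  if keepL then D.L (z.fst (Fin.last K)) else 0

/-- The linearized objective around `c`, that is, the model without indicator function and
proximal term. -/
def linModel (keepL : Bool) (ε γ : ℝ) (c z : DecVec nx nu Nu K) : ℝ :=
  D.keptCost keepL z + outerH (D.G keepL ε γ c + fderiv ℝ (D.G keepL ε γ) c (z - c))

/-- The finite part of `Θ_γ`. -/
def penalized (ε γ : ℝ) (z : DecVec nx nu Nu K) : ℝ :=
  D.objective z + γ * ∑ k : Fin K, max 0 (D.xi k (z.fst k.castSucc) z.snd - ε)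

theorem penalized_eq (keepL : Bool) (ε : ℝ) {γ : ℝ} (hγ : 0 ≤ γ) (z : DecVec nx nu Nu K) :
    D.penalized ε γ z = D.keptCost keepL z + outerH (D.G keepL ε γ z) := by
  have h1 : outerH (D.G keepL ε γ z) = (if keepL then 0 else D.L (z.fst (Fin.last K)))
      + ∑ k : Fin K, D.Yk k (z.fst k.castSucc) z.snd
      + ∑ k : Fin K, max 0 (γ * (D.xi k (z.fst k.castSucc) z.snd - ε)) := rfl
  have h2 : ∀ k : Fin K, max 0 (γ * (D.xi k (z.fst k.castSucc) z.snd - ε))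
      = γ * max 0 (D.xi k (z.fst k.castSucc) z.snd - ε) := fun k => by
    rw [mul_max_of_nonneg _ _ hγ, mul_zero]
  rw [h1, Finset.sum_congr rfl fun k _ => h2 k, ← Finset.mul_sum, penalized, objective, keptCost]
  cases keepL with
  | false => simp
  | true => simp; ring

theorem continuous_penalized (ε γ : ℝ) : Continuous (D.penalized ε γ) :=
  D.continuous_objective.add (continuous_const.mul (continuous_finsetSum _ fun k _ =>
    continuous_const.max ((D.differentiable_xi k).continuous.sub continuous_const)))

theorem differentiable_keptCost (keepL : Bool) : Differentiable ℝ (D.keptCost keepL) := by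
  cases keepL
  · exact differentiable_const (0 : ℝ)
  · exact D.differentiable_terminal

theorem convexOn_keptCost (keepL : Bool) : ConvexOn ℝ univ (D.keptCost keepL) := by
  cases keepL
  · exact convexOn_const (0 : ℝ) convex_univ
  · exact D.convexOn_terminal

theorem convexOn_linModel (keepL : Bool) (ε γ : ℝ) (c : DecVec nx nu Nu K) :
    ConvexOn ℝ univ (D.linModel keepL ε γ c) := by
  refine (D.convexOn_keptCost keepL).add ?_
  have h := ((convexOn_outerH K).translate_right (D.G keepL ε γ c
    - fderiv ℝ (D.G keepL ε γ) c c)).comp_linearMap (fderiv ℝ (D.G keepL ε γ) c).toLinearMap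
  simp only [preimage_univ] at h
  refine h.congr fun z _ => ?_
  simp only [Function.comp_apply, ContinuousLinearMap.coe_coe, map_sub]
  congr 1
  abel

/-- The linearized objective minorizes the penalized objective: the components of `G` are convex
and `H` is monotone. -/
theorem linModel_le_penalized (keepL : Bool) (ε : ℝ) {γ : ℝ} (hγ : 0 ≤ γ)
    (c z : DecVec nx nu Nu K) : D.linModel keepL ε γ c z ≤ D.penalized ε γ z := by
  rw [D.penalized_eq keepL ε hγ, linModel]
  have hG := (D.differentiable_G keepL ε γ c).hasFDerivAt
  gcongr
  refine outerH_mono ?_ fun k => ?_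
  · exact (D.convexOn_G_fst keepL ε γ).le_of_hasFDerivAt
      ((WithLp.fstL 2 ℝ ℝ (EuclideanSpace ℝ (Fin K))).hasFDerivAt.comp c hG) z
  · exact (D.convexOn_G_snd keepL ε hγ k).le_of_hasFDerivAt
      (((PiLp.proj (𝕜 := ℝ) 2 (fun _ : Fin K => ℝ) k).comp
        (WithLp.sndL 2 ℝ ℝ (EuclideanSpace ℝ (Fin K)))).hasFDerivAt.comp c hG) z

/-- The prox-linear model majorizes the penalized objective on `𝒵`, by the descent lemma. -/
theorem penalized_le_linModel_add (keepL : Bool) (ε : ℝ) {γ ρ : ℝ} (hγ : 0 ≤ γ) (hρ : 0 < ρ)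
    {α β : ℝ≥0} (hH : LipschitzWith α (outerH (K := K)))
    (hG : LipschitzOnWith β (fderiv ℝ (D.G keepL ε γ)) D.Zset)
    (hρ_le : ρ ≤ 1 / ((α : ℝ) * (β : ℝ))) {c z : DecVec nx nu Nu K} (hc : c ∈ D.Zset)
    (hz : z ∈ D.Zset) :
    D.penalized ε γ z ≤ D.linModel keepL ε γ c z + 1 / (2 * ρ) * ‖z - c‖ ^ 2 := by
  have h1 := D.convex_Zset.norm_sub_linearization_le
    (fun x _ => (D.differentiable_G keepL ε γ x).hasFDerivAt) hG hc hz
  have h2 := (le_abs_self _).trans (hH.dist_le_mul (D.G keepL ε γ z)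
    (D.G keepL ε γ c + fderiv ℝ (D.G keepL ε γ) c (z - c)))
  rw [dist_eq_norm] at h2
  have h3 : (α : ℝ) * β ≤ 1 / ρ := by
    rcases (mul_nonneg α.coe_nonneg β.coe_nonneg).eq_or_lt with h | h
    · rw [← h]; positivity
    · exact (le_one_div hρ h).1 hρ_le
  have h4 : (α : ℝ) * ‖D.G keepL ε γ z - (D.G keepL ε γ c
      + fderiv ℝ (D.G keepL ε γ) c (z - c))‖ ≤ 1 / (2 * ρ) * ‖z - c‖ ^ 2 := calc
    _ ≤ (α : ℝ) * (β / 2 * ‖z - c‖ ^ 2) := by gcongr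
    _ = (α * β) * (‖z - c‖ ^ 2 / 2) := by ring
    _ ≤ 1 / ρ * (‖z - c‖ ^ 2 / 2) := by gcongr
    _ = _ := by field_simp
  rw [D.penalized_eq keepL ε hγ, linModel]
  linarith

/-! ### Prox-linear steps -/

theorem proxModel_of_mem (keepL : Bool) (ε γ ρ : ℝ) (c : DecVec nx nu Nu K)
    {z : DecVec nx nu Nu K} (hz : z ∈ D.Zset) : D.proxModel keepL ε γ ρ c z
      = ((D.linModel keepL ε γ c z + 1 / (2 * ρ) * ‖z - c‖ ^ 2 : ℝ) : EReal) := by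
  rw [proxModel, J, indicatorZ, if_pos hz, zero_add, ← EReal.coe_add, linModel, keptCost, add_assoc]

theorem proxModel_of_notMem (keepL : Bool) (ε γ ρ : ℝ) (c : DecVec nx nu Nu K)
    {z : DecVec nx nu Nu K} (hz : z ∉ D.Zset) : D.proxModel keepL ε γ ρ c z = ⊤ := by
  rw [proxModel, J, indicatorZ, if_neg hz, EReal.top_add_coe, EReal.top_add_coe]

theorem isProxMin_iff (hne : D.Zset.Nonempty) (keepL : Bool) (ε γ ρ : ℝ)
    (c z : DecVec nx nu Nu K) : D.IsProxMin keepL ε γ ρ c z ↔ z ∈ D.Zset ∧ ∀ z' ∈ D.Zset,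
      D.linModel keepL ε γ c z + 1 / (2 * ρ) * ‖z - c‖ ^ 2
        ≤ D.linModel keepL ε γ c z' + 1 / (2 * ρ) * ‖z' - c‖ ^ 2 := by
  constructor
  · intro h
    have hz : z ∈ D.Zset := by
      by_contra hz
      obtain ⟨y, hy⟩ := hne
      have := h y
      rw [D.proxModel_of_notMem _ _ _ _ _ hz, D.proxModel_of_mem _ _ _ _ _ hy, top_le_iff] at this
      exact EReal.coe_ne_top _ this
    refine ⟨hz, fun z' hz' => ?_⟩
    have := h z'
    rwa [D.proxModel_of_mem _ _ _ _ _ hz, D.proxModel_of_mem _ _ _ _ _ hz',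
      EReal.coe_le_coe_iff] at this
  · rintro ⟨hz, h⟩ z'
    by_cases hz' : z' ∈ D.Zset
    · rw [D.proxModel_of_mem _ _ _ _ _ hz, D.proxModel_of_mem _ _ _ _ _ hz',
        EReal.coe_le_coe_iff]
      exact h z' hz'
    · rw [D.proxModel_of_notMem _ _ _ _ _ hz']
      exact le_top

theorem IsProxMin.growth {D : ConvexOCP nx nu Nu K ng nh nP nQ} (hne : D.Zset.Nonempty)
    {keepL : Bool} {ε γ ρ : ℝ} {c p z : DecVec nx nu Nu K} (h : D.IsProxMin keepL ε γ ρ c p)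
    (hz : z ∈ D.Zset) :
    D.linModel keepL ε γ c p + 1 / (2 * ρ) * ‖p - c‖ ^ 2 + 1 / (2 * ρ) * ‖z - p‖ ^ 2
      ≤ D.linModel keepL ε γ c z + 1 / (2 * ρ) * ‖z - c‖ ^ 2 :=
  have h' := (D.isProxMin_iff hne keepL ε γ ρ c p).1 h
  ((D.convexOn_linModel keepL ε γ c).subset (subset_univ _) D.convex_Zset).prox_growth h'.1 h'.2 hz

theorem existsUnique_isProxMin (hne : D.Zset.Nonempty) (keepL : Bool) (ε γ : ℝ) {ρ : ℝ}
    (hρ : 0 < ρ) {α : ℝ≥0} (hH : LipschitzWith α (outerH (K := K))) (c : DecVec nx nu Nu K) :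
    ∃! z, D.IsProxMin keepL ε γ ρ c z := by
  have hcont : Continuous (D.linModel keepL ε γ c) :=
    (D.differentiable_keptCost keepL).continuous.add (hH.continuous.comp (continuous_const.add
      ((fderiv ℝ (D.G keepL ε γ) c).continuous.comp (continuous_id.sub continuous_const))))
  have hlow : ∀ z, D.linModel keepL ε γ c c - (‖fderiv ℝ (D.keptCost keepL) c‖
      + α * ‖fderiv ℝ (D.G keepL ε γ) c‖) * ‖z - c‖ ≤ D.linModel keepL ε γ c z := fun z => by
    have h1 := (D.convexOn_keptCost keepL).le_of_hasFDerivAt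
      (D.differentiable_keptCost keepL c).hasFDerivAt z
    have h2 := (abs_le.1 ((fderiv ℝ (D.keptCost keepL) c).le_opNorm (z - c))).1
    have h3 := (le_abs_self _).trans (hH.dist_le_mul (D.G keepL ε γ c)
      (D.G keepL ε γ c + fderiv ℝ (D.G keepL ε γ) c (z - c)))
    rw [dist_self_add_right] at h3
    have h4 := mul_le_mul_of_nonneg_left ((fderiv ℝ (D.G keepL ε γ) c).le_opNorm (z - c))
      (NNReal.coe_nonneg α)
    simp only [linModel, sub_self, map_zero, add_zero]
    linarith
  obtain ⟨p, hp, hmin⟩ := exists_prox_minimizer D.isClosed_Zset hne hcont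
    (r := 1 / (2 * ρ)) (by positivity) c hlow
  have hpm := (D.isProxMin_iff hne keepL ε γ ρ c p).2 ⟨hp, hmin⟩
  refine ⟨p, hpm, fun q hq => ?_⟩
  have hq' := (D.isProxMin_iff hne keepL ε γ ρ c q).1 hq
  have h1 := hpm.growth hne hq'.1
  have h2 := hq'.2 p hp
  have h3 : 0 < 1 / (2 * ρ) := by positivity
  have h4 : ‖q - p‖ ^ 2 ≤ 0 := nonpos_of_mul_nonpos_right (by linarith) h3
  exact sub_eq_zero.1 (norm_eq_zero.1 (pow_eq_zero_iff two_ne_zero |>.1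
    (le_antisymm h4 (sq_nonneg _))))

/-! ### Exact penalization -/

theorem IsSolution.exists_isMultiplier {D : ConvexOCP nx nu Nu K ng nh nP nQ} {ε : ℝ}
    (hslater : D.StrongSlater ε) {z : DecVec nx nu Nu K} (hz : D.IsSolution ε z) :
    ∃ μ, D.IsMultiplier ε z μ := by
  obtain ⟨zs, hzs, hlt⟩ := hslater.exists_mem_Zset
  have hsub : ∀ {f : DecVec nx nu Nu K → ℝ}, ConvexOn ℝ univ f → ConvexOn ℝ D.Zset f :=
    fun hf => hf.subset (subset_univ _) D.convex_Zset
  obtain ⟨μ, h1, h2, h3⟩ := exists_lagrange_multiplier (hsub D.convexOn_objective)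
    (g := fun (k : Fin K) z => D.xi k (z.fst k.castSucc) z.snd - ε)
    (fun k => hsub ((D.convexOn_xi k).sub (concaveOn_const ε convex_univ)))
    hz.1.1 (fun k => sub_nonpos.2 (hz.1.2 k))
    (fun z' hz' hf => hz.2 z' ⟨hz', fun k => sub_nonpos.1 (hf k)⟩) hzs
    (fun k => sub_neg.2 (hlt k))
  refine ⟨μ, h1, h2, fun z' hz' => ?_⟩
  rw [Finset.sum_eq_zero fun k _ => h2 k, add_zero]
  exact h3 z' hz'

/-- A solution minimizes the penalized objective over `𝒵`, and all other minimizers are solutions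
as well, if the penalty weight exceeds a vector of multipliers of the solution. -/
theorem IsSolution.exact_penalty {D : ConvexOCP nx nu Nu K ng nh nP nQ} {ε γ : ℝ}
    {z : DecVec nx nu Nu K} (hz : D.IsSolution ε z) {μ : Fin K → ℝ} (hμ : D.IsMultiplier ε z μ)
    (hμγ : ∀ k, μ k < γ) :
    (∀ y ∈ D.Zset, D.penalized ε γ z ≤ D.penalized ε γ y) ∧
      ∀ y ∈ D.Zset, D.penalized ε γ y ≤ D.penalized ε γ z → D.IsSolution ε y := by
  have hpen : D.penalized ε γ z = D.objective z := by
    rw [penalized, Finset.sum_eq_zero fun k _ => max_eq_left (sub_nonpos.2 (hz.1.2 k)), mul_zero,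
      add_zero]
  -- Replacing `γ` by `μ k` in the penalty leaves a surplus `(γ - μ k) max 0 (ξ_k - ε)`.
  have key : ∀ y ∈ D.Zset, D.objective z + ∑ k : Fin K,
      (γ - μ k) * max 0 (D.xi k (y.fst k.castSucc) y.snd - ε) ≤ D.penalized ε γ y := fun y hy => by
    have h1 := hμ.2.2 y hy
    rw [Finset.sum_eq_zero fun k _ => hμ.2.1 k, add_zero] at h1
    have h2 : ∑ k, μ k * (D.xi k (y.fst k.castSucc) y.snd - ε)
        ≤ ∑ k, μ k * max 0 (D.xi k (y.fst k.castSucc) y.snd - ε) :=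
      Finset.sum_le_sum fun k _ => mul_le_mul_of_nonneg_left (le_max_right _ _) (hμ.1 k)
    simp only [penalized, sub_mul, Finset.sum_sub_distrib, ← Finset.mul_sum]
    linarith
  have hnn : ∀ y : DecVec nx nu Nu K, ∀ k ∈ Finset.univ,
      0 ≤ (γ - μ k) * max 0 (D.xi k (y.fst k.castSucc) y.snd - ε) := fun y k _ =>
    mul_nonneg (sub_nonneg.2 (hμγ k).le) (le_max_left _ _)
  refine ⟨fun y hy => ?_, fun y hy hle => ?_⟩
  · rw [hpen]
    linarith [key y hy, Finset.sum_nonneg (hnn y)]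
  · rw [hpen] at hle
    have h1 := (Finset.sum_eq_zero_iff_of_nonneg (hnn y)).1
      (le_antisymm (by linarith [key y hy]) (Finset.sum_nonneg (hnn y)))
    have hmax : ∀ k : Fin K, max 0 (D.xi k (y.fst k.castSucc) y.snd - ε) = 0 := fun k =>
      (mul_eq_zero.1 (h1 k (Finset.mem_univ k))).resolve_left (sub_pos.2 (hμγ k)).ne'
    have hobj : D.penalized ε γ y = D.objective y := by
      rw [penalized, Finset.sum_eq_zero fun k _ => hmax k, mul_zero, add_zero]
    refine ⟨⟨hy, fun k => sub_nonpos.1 (max_eq_left_iff.1 (hmax k))⟩, fun z' hz' => ?_⟩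
    exact (hobj ▸ hle).trans (hz.2 z' hz')

/-! ### The stopping rule -/

theorem proxLinear_eq_iterate (keepL : Bool) (ε γ ρ tol : ℝ) {m : ℕ} {z : DecVec nx nu Nu K}
    (hlt : ∀ i < m, tol < ‖D.proxGrad keepL ε γ ρ ((D.proxStep keepL ε γ ρ)^[i] z)‖)
    (hle : ‖D.proxGrad keepL ε γ ρ ((D.proxStep keepL ε γ ρ)^[m] z)‖ ≤ tol) {n : ℕ}
    (hmn : m ≤ n) :
    D.proxLinear keepL ε γ ρ tol n z = (D.proxStep keepL ε γ ρ)^[m] z := by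
  induction n generalizing m z with
  | zero =>
    obtain rfl : m = 0 := Nat.le_zero.1 hmn
    rfl
  | succ n ih =>
    cases m with
    | zero => rw [proxLinear, if_neg (not_lt.2 (by exact hle))]; rfl
    | succ m =>
      rw [proxLinear, if_pos (by exact hlt 0 m.succ_pos)]
      exact ih (fun i hi => hlt (i + 1) (Nat.succ_lt_succ hi)) hle (Nat.le_of_succ_le_succ hmn)

end ConvexOCP

/-- If the iterates of `S` converge and the residual `e` vanishes at fixed points of `S` only, then
iterates with small residual are near the limit: the early iterates have residuals bounded away
from `0`, unless one of them is a fixed point and thus the limit. -/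
theorem exists_tol_dist_lt_of_iterate {X : Type*} [MetricSpace X] {S : X → X} {e : X → ℝ}
    (he0 : ∀ x, 0 ≤ e x) (he : ∀ x, e x = 0 → S x = x) {x y : X}
    (hlim : Tendsto (fun n => S^[n] x) atTop (𝓝 y)) {δ : ℝ} (hδ : 0 < δ) :
    ∃ tol₀ > 0, ∀ n, e (S^[n] x) ≤ tol₀ → dist (S^[n] x) y < δ := by
  obtain ⟨N, hN⟩ := Metric.tendsto_atTop.1 hlim δ hδ
  have hev : ∀ᶠ τ : ℝ in 𝓝[>] 0, ∀ n ∈ Finset.range N, e (S^[n] x) ≠ 0 → τ < e (S^[n] x) := by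
    rw [Filter.eventually_all_finset]
    intro n _
    rcases eq_or_ne (e (S^[n] x)) 0 with h | h
    · exact Eventually.of_forall fun τ h' => absurd h h'
    · filter_upwards [Ioo_mem_nhdsGT ((he0 (S^[n] x)).lt_of_ne h.symm)] with τ hτ _ using hτ.2
  obtain ⟨τ, hτ, hτ0⟩ := (hev.and self_mem_nhdsWithin).exists
  refine ⟨τ, hτ0, fun n hn => ?_⟩
  rcases le_or_gt N n with h | h
  · exact hN n h
  · have hz : e (S^[n] x) = 0 := by
      by_contra hne
      exact absurd hn (not_le.2 (hτ n (Finset.mem_range.2 h) hne))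
    have hfix : ∀ m, S^[m + n] x = S^[n] x := fun m => by
      rw [Function.iterate_add_apply]
      exact Function.iterate_fixed (he _ hz) m
    have hconst : y = S^[n] x := tendsto_nhds_unique
      ((tendsto_add_atTop_iff_nat n).2 hlim) (by simpa only [hfix] using tendsto_const_nhds)
    rw [← hconst, dist_self]
    exact hδ

end

/-! ### Convergence of the prox-linear method -/

theorem mainTheorem3 {nx nu Nu K ng nh nP nQ : ℕ} (D : ConvexOCP nx nu Nu K ng nh nP nQ)
    (keepL : Bool) (ε γ ρ : ℝ) (hε : 0 < ε) (hγ : 0 < γ) (hρ : 0 < ρ)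
    (hslater : D.StrongSlater ε)
    (hsol : ∃ z, D.IsSolution ε z)
    (hmult : ∀ (z : DecVec nx nu Nu K) (μ : Fin K → ℝ),
      D.IsSolution ε z → D.IsMultiplier ε z μ → ∀ k, μ k < γ)
    (α β : ℝ≥0) (hβ : 0 < β)
    (hH : LipschitzWith α (outerH (K := K)))
    (hG : LipschitzOnWith β (fderiv ℝ (D.G keepL ε γ)) D.Zset)
    (hρ_le : ρ ≤ 1 / ((α : ℝ) * (β : ℝ))) :
    (∀ c : DecVec nx nu Nu K, ∃! z, D.IsProxMin keepL ε γ ρ c z) ∧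
    ∀ z₁ : DecVec nx nu Nu K, ∃ zstar : DecVec nx nu Nu K, D.IsSolution ε zstar ∧
      Tendsto (fun n : ℕ => (D.proxStep keepL ε γ ρ)^[n] z₁) atTop (𝓝 zstar) ∧
      ∀ δ : ℝ, 0 < δ → ∃ tol₀ : ℝ, 0 < tol₀ ∧ ∀ tol : ℝ, 0 < tol → tol ≤ tol₀ →
        ∃ n₀ : ℕ, ∀ kmax : ℕ, n₀ ≤ kmax →
          ‖D.proxGrad keepL ε γ ρ (D.proxLinear keepL ε γ ρ tol kmax z₁)‖ ≤ tol ∧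
          ‖D.proxLinear keepL ε γ ρ tol kmax z₁ - zstar‖ < δ := by
  obtain ⟨w, hw⟩ := hsol
  have hne : D.Zset.Nonempty := ⟨w, hw.1.1⟩
  have hex := D.existsUnique_isProxMin hne keepL ε γ hρ hH
  refine ⟨hex, fun z₁ => ?_⟩
  have hstep : ∀ c, D.IsProxMin keepL ε γ ρ c (D.proxStep keepL ε γ ρ c) := fun c =>
    Classical.epsilon_spec (hex c).exists
  have hmem : ∀ c, D.proxStep keepL ε γ ρ c ∈ D.Zset := fun c =>
    ((D.isProxMin_iff hne keepL ε γ ρ c _).1 (hstep c)).1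
  obtain ⟨μ, hμ⟩ := hw.exists_isMultiplier hslater
  have hpen := hw.exact_penalty hμ (hmult w μ hw hμ)
  -- The initial point may lie outside `𝒵`, so that the first step is left out.
  have humem : ∀ n, (D.proxStep keepL ε γ ρ)^[n + 1] z₁ ∈ D.Zset := fun n => by
    rw [Function.iterate_succ_apply']
    exact hmem _
  obtain ⟨y, hy, hymin, hlim⟩ := exists_tendsto_minimizer_of_prox_inequality D.isClosed_Zset
    (D.continuous_penalized ε γ) (r := 1 / (2 * ρ)) (by positivity) humem
    (fun n z hz => by
      have hc := humem n
      rw [Function.iterate_succ_apply' _ (n + 1)]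
      generalize (D.proxStep keepL ε γ ρ)^[n + 1] z₁ = c at hc
      linarith [(hstep c).growth hne hz, D.linModel_le_penalized keepL ε hγ.le c z,
        D.penalized_le_linModel_add keepL ε hγ.le hρ hH hG hρ_le hc (hmem c)])
    hw.1.1 hpen.1
  have hlim' : Tendsto (fun n : ℕ => (D.proxStep keepL ε γ ρ)^[n] z₁) atTop (𝓝 y) :=
    (tendsto_add_atTop_iff_nat 1).1 hlim
  refine ⟨y, hpen.2 y hy (hymin w hw.1.1), hlim', fun δ hδ => ?_⟩
  obtain ⟨tol₀, htol₀, hnear⟩ := exists_tol_dist_lt_of_iterate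
    (e := fun c => ‖D.proxGrad keepL ε γ ρ c‖) (fun c => norm_nonneg _) (fun c hc => by
      have h1 := (smul_eq_zero.1 (norm_eq_zero.1 hc)).resolve_left (by positivity)
      exact (sub_eq_zero.1 h1).symm) hlim' hδ
  refine ⟨tol₀, htol₀, fun tol htol hle => ?_⟩
  have hres : Tendsto (fun n : ℕ => ‖D.proxGrad keepL ε γ ρ ((D.proxStep keepL ε γ ρ)^[n] z₁)‖)
      atTop (𝓝 0) := by
    have h1 : Tendsto (fun n : ℕ => (D.proxStep keepL ε γ ρ)^[n + 1] z₁) atTop (𝓝 y) := hlim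
    have h2 := ((hlim'.sub h1).const_smul (1 / ρ)).norm
    simp only [Function.iterate_succ_apply', sub_self, smul_zero, norm_zero] at h2
    exact h2
  classical
  have hreach : ∃ n : ℕ, ‖D.proxGrad keepL ε γ ρ ((D.proxStep keepL ε γ ρ)^[n] z₁)‖ ≤ tol :=
    (hres.eventually_le_const htol).exists
  refine ⟨Nat.find hreach, fun kmax hk => ?_⟩
  rw [D.proxLinear_eq_iterate keepL ε γ ρ tol (fun i hi => not_le.1 (Nat.find_min hreach hi))
    (Nat.find_spec hreach) hk]
  refine ⟨Nat.find_spec hreach, ?_⟩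
  rw [← dist_eq_norm]
  exact hnear _ ((Nat.find_spec hreach).trans hle)
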